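/- Intuitionistic arithmetic $\mathsf{HA}$ is formulated in the first-order language with logical constants $\forall,\exists,\to,\land,\lor,\perp$, equality, and function symbols for all primitive recursive functions; its non-logical axioms are those of equality, $Sx\neq 0$, $Sx=Sy\to x=y$, the defining equations of the primitive recursive functions, and induction for all formulas. Here $\neg\varphi$ is $\varphi\to\perp$. Classical arithmetic $\mathsf{PA}$ is $\mathsf{HA}$ plus the law of excluded middle for all formulas. A theory is given by a set of axioms and uses intuitionistic derivability. $\mathrm{FV}(\varphi)$ is the set of free variables of $\varphi$. Classes of formulas. $\Sigma_0=\Pi_0$ is the class of quantifier-free formulas; $\Sigma_{k+1}$ consists of the formulas $\exists x_1\cdots\exists x_n\,\psi$ with $\psi\in\Pi_k$, and $\Pi_{k+1}$ of the formulas $\forall x_1\cdots\forall x_n\,\psi$ with $\psi\in\Sigma_k$ (blocks of quantifiers may be empty, $n\ge 0$). The set $\mathrm{Alt}(\varphi)$ of alternation paths of $\varphi$, a finite set of finite alternating sequences of $+$ and $-$, is defined as follows: $\mathrm{Alt}(\varphi)=\{\langle\,\rangle\}$ for quantifier-free $\varphi$; otherwise $\mathrm{Alt}(\neg\varphi_1)=\{s^\perp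 : s\in\mathrm{Alt}(\varphi_1)\}$, where $s^\perp$ is $s$ with $+$ and $-$ exchanged; $\mathrm{Alt}(\varphi_1\land\varphi_2)=\mathrm{Alt}(\varphi_1\lor\varphi_2)=\mathrm{Alt}(\varphi_1)\cup\mathrm{Alt}(\varphi_2)$; $\mathrm{Alt}(\varphi_1\to\varphi_2)=\{s^\perp: s\in\mathrm{Alt}(\varphi_1)\}\cup\mathrm{Alt}(\varphi_2)$ (if $\varphi_2$ is not $\perp$); $\mathrm{Alt}(\forall x\,\varphi_1)$ is obtained from $\mathrm{Alt}(\varphi_1)$ by putting $-$ in front of every path that does not begin with $-$, and $\mathrm{Alt}(\exists x\,\varphi_1)$ by putting $+$ in front of every path that does not begin with $+$. Let $\mathrm{F}_k$ be the class of formulas whose longest alternation path has length exactly $k$. Put $\mathrm{U}_0=\mathrm{E}_0=\mathrm{F}_0$; $\mathrm{U}_{k+1}$ (resp. $\mathrm{E}_{k+1}$) is the class of $\varphi\in\mathrm{F}_{k+1}$ all of whose alternation paths of length $k+1$ begin with $-$ (resp. with $+$); and $\mathrm{U}_k^+=\mathrm{U}_k\cup\bigcup_{i<k}\mathrm{F}_i$.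 For a class $\Gamma$, let $\neg\Gamma=\{\neg\varphi:\varphi\in\Gamma\}$ and $\neg\neg\Gamma=\{\neg\neg\varphi:\varphi\in\Gamma\}$. $\mathrm{U}_k^+\text{-}\mathrm{DNS}$ (double negation shift) is the schema $\forall x\,(\forall y\,\neg\neg\varphi(x,y)\to\neg\neg\forall y\,\varphi(x,y))$, where $\varphi\in\mathrm{U}_k^+$ and $\mathrm{FV}(\varphi)\subseteq\{x,y\}$; a theory proves a schema if it proves all its instances. For a theory $T$ and classes $\Gamma,\Gamma'$, let $\mathrm{PNFT}_T(\Gamma,\Gamma')$ be the statement: for every $\varphi\in\Gamma$ there is $\varphi'\in\Gamma'$ with $\mathrm{FV}(\varphi)=\mathrm{FV}(\varphi')$ and $T\vdash\varphi\leftrightarrow\varphi'$. **Theorem.** Let $T$ be a theory in-between $\mathsf{HA}$ and $\mathsf{PA}$ (everything provable in $\mathsf{HA}$ is provable in $T$, and everything provable in $T$ is provable in $\mathsf{PA}$), and let $k$ be a natural number. The following are pairwise equivalent: 1. $T\vdash\mathrm{U}_k^+\text{-}\mathrm{DNS}$; 2. $\mathrm{PNFT}_T(\neg\mathrm{E}_{k'},\neg\neg\Pi_{k'})$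 for all $k'\le k$; 3. $\mathrm{PNFT}_T(\neg\neg\mathrm{U}_{k'},\neg\neg\Pi_{k'})$ for all $k'\le k$. -/

import Mathlib

open FirstOrder

namespace SemiClassical

/-- Function symbols: one for each description of a primitive recursive function
(`prec f g` is the function `h` with `h(0, v) = f(v)` and `h(y + 1, v) = g(y, h(y, v), v)`). -/
inductive PRSymbol : ℕ → Type
  | zero : PRSymbol 0
  | succ : PRSymbol 1
  | proj {n : ℕ} (i : Fin n) : PRSymbol n
  | comp {m n : ℕ} (f : PRSymbol n) (g : Fin n → PRSymbol m) : PRSymbol m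
  | prec {n : ℕ} (f : PRSymbol n) (g : PRSymbol (n + 2)) : PRSymbol (n + 1)

/-- The language of arithmetic: all primitive recursive function symbols; equality, which is part
of the formulas below, is the only predicate. -/
def LA : Language := ⟨PRSymbol, fun _ => Empty⟩

/-- Terms, with variables indexed by `ℕ` (de Bruijn indices). -/
abbrev Tm : Type := LA.Term ℕ

/-- The term `f(ts)`. -/
def app {n : ℕ} (f : PRSymbol n) (ts : Fin n → Tm) : Tm :=
  Language.Term.func (L := LA) f ts

/-- The variable with index `n`. -/
def v (n : ℕ) : Tm := Language.Term.var n

/-- The term `0`. -/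
def zeroTm : Tm := app PRSymbol.zero Fin.elim0

/-- The term `S t`. -/
def succTm (t : Tm) : Tm := app PRSymbol.succ (fun _ => t)

/-- Formulas of arithmetic, up to renaming of bound variables: a quantifier binds the variable
with index `0` of its body, and the index `n + 1` of the body is the index `n` outside. -/
inductive Fml : Type
  | eq (s t : Tm) : Fml
  | falsum : Fml
  | and (φ ψ : Fml) : Fml
  | or (φ ψ : Fml) : Fml
  | imp (φ ψ : Fml) : Fml
  | all (φ : Fml) : Fml
  | ex (φ : Fml) : Fml

namespace Fml

/-- Negation `φ → ⊥`. -/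
def neg (φ : Fml) : Fml := imp φ falsum

/-- The equivalence of two formulas. -/
def iff (φ ψ : Fml) : Fml := and (imp φ ψ) (imp ψ φ)

/-- The set of (indices of) free variables. -/
def FV : Fml → Set ℕ
  | eq s t => ↑s.varFinset ∪ ↑t.varFinset
  | falsum => ∅
  | and φ ψ => FV φ ∪ FV ψ
  | or φ ψ => FV φ ∪ FV ψ
  | imp φ ψ => FV φ ∪ FV ψ
  | all φ => {n | n + 1 ∈ FV φ}
  | ex φ => {n | n + 1 ∈ FV φ}

/-- A substitution, moved under a quantifier. -/
def up (σ : ℕ → Tm) : ℕ → Tm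
  | 0 => v 0
  | n + 1 => (σ n).relabel Nat.succ

/-- Simultaneous capture-avoiding substitution of terms for the free variables. -/
def subst : Fml → (ℕ → Tm) → Fml
  | eq s t, σ => eq (s.subst σ) (t.subst σ)
  | falsum, _ => falsum
  | and φ ψ, σ => and (subst φ σ) (subst ψ σ)
  | or φ ψ, σ => or (subst φ σ) (subst ψ σ)
  | imp φ ψ, σ => imp (subst φ σ) (subst ψ σ)
  | all φ, σ => all (subst φ (up σ))
  | ex φ, σ => ex (subst φ (up σ))

/-- `φ` with every free index increased by one, so that the index `0` becomes fresh. -/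
def shift (φ : Fml) : Fml := φ.subst (fun n => v (n + 1))

/-- `φ[t/x]`, where `x` is the variable with index `0`, which disappears (the indices of the other
variables go down by one): the instance at `t` of the body of a quantifier. -/
def inst (φ : Fml) (t : Tm) : Fml :=
  φ.subst (fun n => match n with
    | 0 => t
    | m + 1 => v m)

/-- `φ[S x/x]`, where `x` is the variable with index `0` (which remains a variable). -/
def succInst (φ : Fml) : Fml :=
  φ.subst (fun n => match n with
    | 0 => succTm (v 0)
    | m + 1 => v (m + 1))

/-- Quantifier-free formulas. -/
def QF : Fml → Prop
  | eq _ _ => True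
  | falsum => True
  | and φ ψ => QF φ ∧ QF ψ
  | or φ ψ => QF φ ∧ QF ψ
  | imp φ ψ => QF φ ∧ QF ψ
  | all _ => False
  | ex _ => False

/-- A block of `n` universal quantifiers in front of `φ`. -/
def allBlock (n : ℕ) (φ : Fml) : Fml := all^[n] φ

/-- A block of `n` existential quantifiers in front of `φ`. -/
def exBlock (n : ℕ) (φ : Fml) : Fml := ex^[n] φ

/-- The set of alternation paths of a formula. A path is a list of signs, where `true` is `+` and
`false` is `-`. (For quantifier-free formulas the clauses give `{[]}`.) -/
def alt : Fml → Finset (List Bool)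
  | eq _ _ => {[]}
  | falsum => {[]}
  | and φ ψ => alt φ ∪ alt ψ
  | or φ ψ => alt φ ∪ alt ψ
  | imp φ falsum => (alt φ).image (List.map not)
  | imp φ ψ => (alt φ).image (List.map not) ∪ alt ψ
  | all φ => (alt φ).image (fun s => if s.head? = some false then s else false :: s)
  | ex φ => (alt φ).image (fun s => if s.head? = some true then s else true :: s)

/-- The degree: the maximal length of an alternation path. -/
def degree (φ : Fml) : ℕ := (alt φ).sup List.length

end Fml

open Fml

/-- Natural deduction for intuitionistic first-order logic: `Derives A Γ φ` says that `φ` follows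
from the open assumptions `Γ` by means of the non-logical axioms `A`. The free variables of
assumptions are kept fixed, while those of axioms are read universally. -/
inductive Derives (A : Set Fml) : List Fml → Fml → Prop
  | ax {Γ : List Fml} {φ : Fml} : φ ∈ A → Derives A Γ φ
  | assume {Γ : List Fml} {φ : Fml} : φ ∈ Γ → Derives A Γ φ
  | falsumE {Γ : List Fml} {φ : Fml} : Derives A Γ falsum → Derives A Γ φ
  | andI {Γ : List Fml} {φ ψ : Fml} :
      Derives A Γ φ → Derives A Γ ψ → Derives A Γ (and φ ψ)
  | andE₁ {Γ : List Fml} {φ ψ : Fml} : Derives A Γ (and φ ψ) → Derives A Γ φ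
  | andE₂ {Γ : List Fml} {φ ψ : Fml} : Derives A Γ (and φ ψ) → Derives A Γ ψ
  | orI₁ {Γ : List Fml} {φ ψ : Fml} : Derives A Γ φ → Derives A Γ (or φ ψ)
  | orI₂ {Γ : List Fml} {φ ψ : Fml} : Derives A Γ ψ → Derives A Γ (or φ ψ)
  | orE {Γ : List Fml} {φ ψ χ : Fml} : Derives A Γ (or φ ψ) →
      Derives A (φ :: Γ) χ → Derives A (ψ :: Γ) χ → Derives A Γ χ
  | impI {Γ : List Fml} {φ ψ : Fml} : Derives A (φ :: Γ) ψ → Derives A Γ (imp φ ψ)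
  | impE {Γ : List Fml} {φ ψ : Fml} :
      Derives A Γ (imp φ ψ) → Derives A Γ φ → Derives A Γ ψ
  | allI {Γ : List Fml} {φ : Fml} : Derives A (Γ.map shift) φ → Derives A Γ (all φ)
  | allE {Γ : List Fml} {φ : Fml} (t : Tm) : Derives A Γ (all φ) → Derives A Γ (φ.inst t)
  | exI {Γ : List Fml} {φ : Fml} (t : Tm) : Derives A Γ (φ.inst t) → Derives A Γ (ex φ)
  | exE {Γ : List Fml} {φ ψ : Fml} : Derives A Γ (ex φ) →
      Derives A (φ :: Γ.map shift) ψ.shift → Derives A Γ ψ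

/-- A theory is given by a set of axioms; it proves what is derivable without assumptions. -/
def Proves (T : Set Fml) (φ : Fml) : Prop := Derives T [] φ

/-- The theory proves every instance of a schema. -/
def ProvesSchema (T S : Set Fml) : Prop := ∀ φ ∈ S, Proves T φ

/-- The axioms of intuitionistic (Heyting) arithmetic. -/
inductive HAAxiom : Fml → Prop
  | eqRefl (t : Tm) : HAAxiom (eq t t)
  | eqSubst (φ : Fml) (s t : Tm) : HAAxiom (imp (eq s t) (imp (φ.inst s) (φ.inst t)))
  | succNeZero (t : Tm) : HAAxiom (neg (eq (succTm t) zeroTm))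
  | succInj (s t : Tm) : HAAxiom (imp (eq (succTm s) (succTm t)) (eq s t))
  | projDef {n : ℕ} (i : Fin n) (ts : Fin n → Tm) :
      HAAxiom (eq (app (PRSymbol.proj i) ts) (ts i))
  | compDef {m n : ℕ} (f : PRSymbol n) (g : Fin n → PRSymbol m) (ts : Fin m → Tm) :
      HAAxiom (eq (app (PRSymbol.comp f g) ts) (app f (fun i => app (g i) ts)))
  | precZero {n : ℕ} (f : PRSymbol n) (g : PRSymbol (n + 2)) (ts : Fin n → Tm) :
      HAAxiom (eq (app (PRSymbol.prec f g) (Fin.cons zeroTm ts)) (app f ts))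
  | precSucc {n : ℕ} (f : PRSymbol n) (g : PRSymbol (n + 2)) (t : Tm) (ts : Fin n → Tm) :
      HAAxiom (eq (app (PRSymbol.prec f g) (Fin.cons (succTm t) ts))
        (app g (Fin.cons t (Fin.cons (app (PRSymbol.prec f g) (Fin.cons t ts)) ts))))
  | induction (φ : Fml) :
      HAAxiom (imp (φ.inst zeroTm) (imp (all (imp φ φ.succInst)) (all φ)))

/-- Intuitionistic arithmetic. -/
def HA : Set Fml := {φ | HAAxiom φ}

/-- Classical arithmetic: intuitionistic arithmetic with the law of excluded middle. -/
def PA : Set Fml := HA ∪ {χ | ∃ φ : Fml, χ = or φ (neg φ)}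

mutual
/-- The class `Σ_k`; blocks of quantifiers may be empty. -/
def SigmaClass : ℕ → Set Fml
  | 0 => {φ | QF φ}
  | k + 1 => {φ | ∃ (n : ℕ) (ψ : Fml), ψ ∈ PiClass k ∧ φ = exBlock n ψ}
/-- The class `Π_k`; blocks of quantifiers may be empty. -/
def PiClass : ℕ → Set Fml
  | 0 => {φ | QF φ}
  | k + 1 => {φ | ∃ (n : ℕ) (ψ : Fml), ψ ∈ SigmaClass k ∧ φ = allBlock n ψ}
end

/-- The class `F_k` of formulas of degree `k`. -/
def FClass (k : ℕ) : Set Fml := {φ | degree φ = k}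

/-- The class `U_k`. -/
def UClass : ℕ → Set Fml
  | 0 => FClass 0
  | k + 1 => {φ | φ ∈ FClass (k + 1) ∧
      ∀ s ∈ alt φ, s.length = k + 1 → s.head? = some false}

/-- The class `E_k`. -/
def EClass : ℕ → Set Fml
  | 0 => FClass 0
  | k + 1 => {φ | φ ∈ FClass (k + 1) ∧
      ∀ s ∈ alt φ, s.length = k + 1 → s.head? = some true}

/-- The class `U_k⁺`. -/
def UPlusClass (k : ℕ) : Set Fml := UClass k ∪ ⋃ i < k, FClass i

/-- The class of the formulas `¬ φ` with `φ ∈ G`. -/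
def negClass (G : Set Fml) : Set Fml := {χ | ∃ φ ∈ G, χ = neg φ}

/-- The class of the formulas `¬ ¬ φ` with `φ ∈ G`. -/
def dnegClass (G : Set Fml) : Set Fml := {χ | ∃ φ ∈ G, χ = neg (neg φ)}

/-- The double negation shift for `G`: the schema `∀ x (∀ y ¬¬ φ(x, y) → ¬¬ ∀ y φ(x, y))` for
`φ(x, y) ∈ G` without free variables other than `x` and `y`, which have the indices `1` and `0`. -/
def DNS (G : Set Fml) : Set Fml :=
  {χ | ∃ φ ∈ G, FV φ ⊆ {0, 1} ∧
    χ = all (imp (all (neg (neg φ))) (neg (neg (all φ))))}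

/-- The prenex normal form statement for `G` and `G'` over `T`: every formula in `G` is
`T`-equivalent to one in `G'` with the same free variables. -/
def PNFT (T G G' : Set Fml) : Prop :=
  ∀ φ ∈ G, ∃ φ' ∈ G', FV φ = FV φ' ∧ Proves T (iff φ φ')

end SemiClassical

open SemiClassical

-- From double negation shift to normal forms. Call two formulas equivalent under double negation if
-- each implies the double negation of the other. Intuitionistically this relation respects `∧`, `¬`
-- and `∃`, and `∨` and `→` reduce to `¬` and `∧`; only `∀`, and the passage from `¬∀` to `∃¬`, need
-- double negation shift for the matrix. When it holds for `U_k⁺`, every formula of `U_k'⁺` or of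
-- the dual class, `k' ≤ k`, thus gets a prenex equivalent under double negation
-- (`PathBound.exists_prenex`). A formula `¬φ` with `φ ∈ E_k'` lies in `U_k'⁺` and is stable, so it
-- is equivalent to the double negation of a `Π_k'`-formula. The schema allows only one parameter;
-- finitely many are coded into one by a pairing function whose equations are proved in `HA`
-- (`hasDNS_of_pathBound`).
--
-- From normal forms to double negation shift. Induct on `k`. For `φ ∈ U_{k+1}⁺` the formulas `¬¬∀y
-- ¬¬φ` and `¬¬∀y φ` are equivalent to `¬¬α` and `¬¬β` with `α, β ∈ Π_{k+1}`. Classical arithmetic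
-- proves `α → β`, and it remains to prove `α → ¬¬β` in `T`.
--
-- This rests on `conservation`: for implications between `Π_{j+2}`-formulas, classical arithmetic
-- is conservative over `HA` with excluded middle for degree at most `j`. The proof uses a negative
-- translation with a formula `R` in place of falsity. Excluded middle makes the translation of a
-- formula of degree at most `j` amount to that formula or `R`; with `R` chosen as the
-- `Σ_{j+1}`-conclusion, the conclusion follows from its own translation. A derivation uses finitely
-- many universal closures of excluded middle. Their double negations are provable in `T` by the
-- shift already obtained, and these suffice for the negated conclusion `¬¬β` (`conservation_dn`).

namespace SemiClassical
open Fml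

/-! ### Substitution -/

namespace Tm

theorem subst_var (t : Tm) : t.subst v = t := by
  induction t with
  | var i => rfl
  | func f ts ih => simp only [Language.Term.subst, ih]

theorem subst_subst (t : Tm) (σ τ : ℕ → Tm) :
    (t.subst σ).subst τ = t.subst (fun n => (σ n).subst τ) := by
  induction t with
  | var i => rfl
  | func f ts ih => simp only [Language.Term.subst, ih]

theorem relabel_eq_subst (t : Tm) (f : ℕ → ℕ) : t.relabel f = t.subst (fun n => v (f n)) := by
  induction t with
  | var i => rfl
  | func g ts ih => simp only [Language.Term.subst, Language.Term.relabel, ih]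

theorem subst_congr (t : Tm) {σ τ : ℕ → Tm} (h : ∀ i ∈ t.varFinset, σ i = τ i) :
    t.subst σ = t.subst τ := by
  induction t with
  | var i => exact h i (by simp)
  | func f ts ih =>
    simp only [Language.Term.subst]
    congr 1
    funext i
    exact ih i fun j hj => h j (by simpa using ⟨i, hj⟩)

theorem mem_varFinset_subst (t : Tm) (σ : ℕ → Tm) (n : ℕ) :
    n ∈ (t.subst σ).varFinset ↔ ∃ i ∈ t.varFinset, n ∈ (σ i).varFinset := by
  induction t with
  | var i => simp [Language.Term.subst]
  | func f ts ih =>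
    simp only [Language.Term.subst, Language.Term.varFinset, Finset.mem_biUnion, Finset.mem_univ,
      true_and, ih]
    constructor
    · rintro ⟨a, i, hi, hn⟩
      exact ⟨i, ⟨a, hi⟩, hn⟩
    · rintro ⟨i, ⟨a, hi⟩, hn⟩
      exact ⟨a, i, hi, hn⟩

end Tm

/-- The substitution `σ` followed by the substitution `τ`. -/
def compSubst (σ τ : ℕ → Tm) : ℕ → Tm := fun n => (σ n).subst τ

/-- The substitution of `t` for the index `0`, which lowers the other indices. -/
def single (t : Tm) : ℕ → Tm
  | 0 => t
  | m + 1 => v m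

/-- The substitution of `t` for the index `0`, which keeps the other indices. -/
def replace (t : Tm) : ℕ → Tm
  | 0 => t
  | m + 1 => v (m + 1)

@[simp] theorem v_subst (n : ℕ) (σ : ℕ → Tm) : (v n).subst σ = σ n := rfl

theorem v_varFinset (n : ℕ) : (v n).varFinset = {n} := rfl

@[simp] theorem app_subst {n : ℕ} (f : PRSymbol n) (ts : Fin n → Tm) (σ : ℕ → Tm) :
    (app f ts).subst σ = app f (fun i => (ts i).subst σ) := rfl

@[simp] theorem zeroTm_subst (σ : ℕ → Tm) : zeroTm.subst σ = zeroTm := by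
  rw [zeroTm, app_subst]
  congr 1
  funext i
  exact i.elim0

@[simp] theorem succTm_subst (t : Tm) (σ : ℕ → Tm) : (succTm t).subst σ = succTm (t.subst σ) := rfl

@[simp] theorem up_zero (σ : ℕ → Tm) : up σ 0 = v 0 := rfl

@[simp] theorem up_succ (σ : ℕ → Tm) (n : ℕ) :
    up σ (n + 1) = (σ n).subst (fun m => v (m + 1)) := Tm.relabel_eq_subst _ _

@[simp] theorem single_zero (t : Tm) : single t 0 = t := rfl
@[simp] theorem single_succ (t : Tm) (n : ℕ) : single t (n + 1) = v n := rfl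
@[simp] theorem replace_zero (t : Tm) : replace t 0 = t := rfl
@[simp] theorem replace_succ (t : Tm) (n : ℕ) : replace t (n + 1) = v (n + 1) := rfl

theorem up_var : up v = v := by
  funext n
  cases n <;> rfl

theorem compSubst_up (σ τ : ℕ → Tm) : compSubst (up σ) (up τ) = up (compSubst σ τ) := by
  funext n
  cases n with
  | zero => rfl
  | succ n => simp [compSubst, Tm.subst_subst]

namespace Fml

theorem subst_var (φ : Fml) : φ.subst v = φ := by
  induction φ with
  | eq s t => simp only [subst, Tm.subst_var]
  | falsum => rfl
  | and φ ψ ih₁ ih₂ => simp only [subst, ih₁, ih₂]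
  | or φ ψ ih₁ ih₂ => simp only [subst, ih₁, ih₂]
  | imp φ ψ ih₁ ih₂ => simp only [subst, ih₁, ih₂]
  | all φ ih => simp only [subst, up_var, ih]
  | ex φ ih => simp only [subst, up_var, ih]

theorem subst_subst (φ : Fml) (σ τ : ℕ → Tm) :
    (φ.subst σ).subst τ = φ.subst (compSubst σ τ) := by
  induction φ generalizing σ τ with
  | eq s t => simp only [subst, Tm.subst_subst]; rfl
  | falsum => rfl
  | and φ ψ ih₁ ih₂ => simp only [subst, ih₁, ih₂]
  | or φ ψ ih₁ ih₂ => simp only [subst, ih₁, ih₂]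
  | imp φ ψ ih₁ ih₂ => simp only [subst, ih₁, ih₂]
  | all φ ih => simp only [subst, ih, compSubst_up]
  | ex φ ih => simp only [subst, ih, compSubst_up]

theorem subst_congr (φ : Fml) {σ τ : ℕ → Tm} (h : ∀ i ∈ FV φ, σ i = τ i) :
    φ.subst σ = φ.subst τ := by
  have hup : ∀ {ψ : Fml} {σ τ : ℕ → Tm}, (∀ i ∈ {n | n + 1 ∈ FV ψ}, σ i = τ i) →
      ∀ i ∈ FV ψ, up σ i = up τ i := by
    intro ψ σ τ h i hi
    cases i with
    | zero => rfl
    | succ i => simp [h i hi]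
  induction φ generalizing σ τ with
  | eq s t =>
    simp only [subst, Tm.subst_congr s fun i hi => h i (Or.inl hi),
      Tm.subst_congr t fun i hi => h i (Or.inr hi)]
  | falsum => rfl
  | and φ ψ ih₁ ih₂ =>
    simp only [subst, ih₁ fun i hi => h i (Or.inl hi), ih₂ fun i hi => h i (Or.inr hi)]
  | or φ ψ ih₁ ih₂ =>
    simp only [subst, ih₁ fun i hi => h i (Or.inl hi), ih₂ fun i hi => h i (Or.inr hi)]
  | imp φ ψ ih₁ ih₂ =>
    simp only [subst, ih₁ fun i hi => h i (Or.inl hi), ih₂ fun i hi => h i (Or.inr hi)]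
  | all φ ih => simp only [subst, ih (hup h)]
  | ex φ ih => simp only [subst, ih (hup h)]

theorem mem_FV_subst (φ : Fml) (σ : ℕ → Tm) (n : ℕ) :
    n ∈ FV (φ.subst σ) ↔ ∃ i ∈ FV φ, n ∈ (σ i).varFinset := by
  have hup : ∀ (ψ : Fml) (σ : ℕ → Tm) (n : ℕ), (∃ i ∈ FV ψ, n + 1 ∈ (up σ i).varFinset) ↔
      ∃ i, i + 1 ∈ FV ψ ∧ n ∈ (σ i).varFinset := by
    intro ψ σ n
    constructor
    · rintro ⟨i, hi, hn⟩
      cases i with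
      | zero => simp [v_varFinset] at hn
      | succ i =>
        rw [up_succ, Tm.mem_varFinset_subst] at hn
        obtain ⟨j, hj, hn⟩ := hn
        simp only [v_varFinset, Finset.mem_singleton, Nat.add_right_cancel_iff] at hn
        exact ⟨i, hi, hn ▸ hj⟩
    · rintro ⟨i, hi, hn⟩
      refine ⟨i + 1, hi, ?_⟩
      rw [up_succ, Tm.mem_varFinset_subst]
      exact ⟨n, hn, by simp [v_varFinset]⟩
  induction φ generalizing σ n with
  | eq s t =>
    simp only [subst, FV, Set.mem_union, Finset.mem_coe, Tm.mem_varFinset_subst, or_and_right,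
      exists_or]
  | falsum => simp [subst, FV]
  | and φ ψ ih₁ ih₂ => simp only [subst, FV, Set.mem_union, ih₁, ih₂, or_and_right, exists_or]
  | or φ ψ ih₁ ih₂ => simp only [subst, FV, Set.mem_union, ih₁, ih₂, or_and_right, exists_or]
  | imp φ ψ ih₁ ih₂ => simp only [subst, FV, Set.mem_union, ih₁, ih₂, or_and_right, exists_or]
  | all φ ih => simp only [subst, FV, Set.mem_ofPred_eq, ih, hup]
  | ex φ ih => simp only [subst, FV, Set.mem_ofPred_eq, ih, hup]

theorem FV_bounded (φ : Fml) : ∃ n, ∀ i ∈ FV φ, i < n := by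
  have hup : ∀ {ψ : Fml}, (∃ n, ∀ i ∈ FV ψ, i < n) → ∃ n, ∀ i ∈ {m | m + 1 ∈ FV ψ}, i < n := by
    rintro ψ ⟨n, h⟩
    exact ⟨n, fun i hi => by have := h _ hi; omega⟩
  have hun : ∀ {s t : Set ℕ}, (∃ n, ∀ i ∈ s, i < n) → (∃ n, ∀ i ∈ t, i < n) →
      ∃ n, ∀ i ∈ s ∪ t, i < n := by
    rintro s t ⟨n, hn⟩ ⟨m, hm⟩
    refine ⟨max n m, fun i hi => ?_⟩
    rcases hi with hi | hi
    · exact lt_max_of_lt_left (hn i hi)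
    · exact lt_max_of_lt_right (hm i hi)
  have hfin : ∀ s : Finset ℕ, ∃ n, ∀ i ∈ (s : Set ℕ), i < n := fun s =>
    ⟨s.sup id + 1, fun i hi => Nat.lt_succ_of_le (Finset.le_sup (f := id) hi)⟩
  induction φ with
  | eq s t => exact hun (hfin _) (hfin _)
  | falsum => exact ⟨0, fun i hi => hi.elim⟩
  | and φ ψ ih₁ ih₂ => exact hun ih₁ ih₂
  | or φ ψ ih₁ ih₂ => exact hun ih₁ ih₂
  | imp φ ψ ih₁ ih₂ => exact hun ih₁ ih₂
  | all φ ih => exact hup ih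
  | ex φ ih => exact hup ih

theorem inst_eq (φ : Fml) (t : Tm) : φ.inst t = φ.subst (single t) := by
  rw [inst]
  congr 1

theorem succInst_eq (φ : Fml) : φ.succInst = φ.subst (replace (succTm (v 0))) := by
  rw [succInst]
  congr 1

theorem shift_inst (φ : Fml) (t : Tm) : φ.shift.inst t = φ := by
  rw [shift, inst_eq, subst_subst]
  exact subst_var φ

theorem shift_subst (φ : Fml) (σ : ℕ → Tm) : (φ.subst σ).shift = φ.shift.subst (up σ) := by
  simp only [shift, subst_subst]
  congr 1
  funext n
  simp [compSubst]

theorem inst_subst (φ : Fml) (t : Tm) (σ : ℕ → Tm) :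
    (φ.inst t).subst σ = (φ.subst (up σ)).inst (t.subst σ) := by
  simp only [inst_eq, subst_subst]
  congr 1
  funext n
  cases n with
  | zero => rfl
  | succ n => simp [compSubst, Tm.subst_subst, Tm.subst_var]

theorem succInst_subst (φ : Fml) (σ : ℕ → Tm) :
    φ.succInst.subst (up σ) = (φ.subst (up σ)).succInst := by
  simp only [succInst_eq, subst_subst]
  congr 1
  funext n
  cases n with
  | zero => rfl
  | succ n => simp [compSubst, Tm.subst_subst]

/-- Instantiating the shift of `∀ φ` or `∃ φ` at the fresh variable gives `φ`. -/
theorem subst_up_shift_inst (φ : Fml) : (φ.subst (up fun n => v (n + 1))).inst (v 0) = φ := by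
  rw [inst_eq, subst_subst]
  conv_rhs => rw [← subst_var φ]
  congr 1
  funext n
  cases n <;> rfl

theorem shift_succInst (φ : Fml) : φ.shift.succInst = φ.shift := by
  simp only [succInst_eq, shift, subst_subst]
  rfl

theorem mem_FV_shift (φ : Fml) (n : ℕ) : n ∈ FV φ.shift ↔ ∃ m ∈ FV φ, n = m + 1 := by
  simp only [shift, mem_FV_subst, v_varFinset, Finset.mem_singleton]

theorem succ_mem_FV_shift (φ : Fml) (n : ℕ) : n + 1 ∈ FV φ.shift ↔ n ∈ FV φ := by
  simp [mem_FV_shift]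

theorem subst_of_FV_eq_empty {φ : Fml} (h : FV φ = ∅) (σ : ℕ → Tm) : φ.subst σ = φ := by
  conv_rhs => rw [← subst_var φ]
  exact subst_congr φ fun i hi => by simp [h] at hi

@[simp] theorem FV_neg (φ : Fml) : FV (neg φ) = FV φ := by simp [neg, FV]

@[simp] theorem neg_subst (φ : Fml) (σ : ℕ → Tm) : (neg φ).subst σ = neg (φ.subst σ) := rfl

/-! ### Alternation paths and prenex classes -/

theorem subst_eq_falsum_iff (φ : Fml) (σ : ℕ → Tm) : φ.subst σ = falsum ↔ φ = falsum := by
  cases φ <;> simp [subst]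

theorem alt_neg (φ : Fml) : alt (neg φ) = (alt φ).image (List.map not) := by
  rw [neg, alt]

theorem alt_imp_of_ne {φ ψ : Fml} (h : ψ ≠ falsum) :
    alt (imp φ ψ) = (alt φ).image (List.map not) ∪ alt ψ := by
  rw [alt]
  exact h

theorem alt_subst (φ : Fml) (σ : ℕ → Tm) : alt (φ.subst σ) = alt φ := by
  induction φ generalizing σ with
  | eq s t => simp only [subst, alt]
  | falsum => rfl
  | and φ ψ ih₁ ih₂ => simp only [subst, alt, ih₁, ih₂]
  | or φ ψ ih₁ ih₂ => simp only [subst, alt, ih₁, ih₂]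
  | imp φ ψ ih₁ ih₂ =>
    by_cases h : ψ = falsum
    · subst h
      simp only [subst, alt, ih₁]
    · rw [subst, alt_imp_of_ne h, alt_imp_of_ne (by rwa [Ne, subst_eq_falsum_iff]), ih₁, ih₂]
  | all φ ih => simp only [subst, alt, ih]
  | ex φ ih => simp only [subst, alt, ih]

theorem QF.subst {φ : Fml} (h : QF φ) (σ : ℕ → Tm) : QF (φ.subst σ) := by
  induction φ generalizing σ with
  | eq s t => trivial
  | falsum => trivial
  | and φ ψ ih₁ ih₂ => exact ⟨ih₁ h.1 σ, ih₂ h.2 σ⟩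
  | or φ ψ ih₁ ih₂ => exact ⟨ih₁ h.1 σ, ih₂ h.2 σ⟩
  | imp φ ψ ih₁ ih₂ => exact ⟨ih₁ h.1 σ, ih₂ h.2 σ⟩
  | all φ ih => exact h.elim
  | ex φ ih => exact h.elim

end Fml

/-- The alternation paths of `φ` have at most the length `k`, and those of length `k` do not begin
with the sign `b`. For `b = true` this is the class `U_k⁺`, for `b = false` it is its dual. -/
def PathBound (b : Bool) (k : ℕ) (φ : Fml) : Prop :=
  ∀ s ∈ alt φ, s.length ≤ k ∧ (s.length = k → s.head? ≠ some b)

theorem PathBound.subst {b : Bool} {k : ℕ} {φ : Fml} (h : PathBound b k φ) (σ : ℕ → Tm) :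
    PathBound b k (φ.subst σ) := by
  rwa [PathBound, alt_subst]

theorem degree_le_iff {φ : Fml} {k : ℕ} : degree φ ≤ k ↔ ∀ s ∈ alt φ, s.length ≤ k := by
  simp [degree]

theorem mem_UPlusClass_iff {k : ℕ} {φ : Fml} : φ ∈ UPlusClass k ↔ PathBound true k φ := by
  constructor
  · rintro (h | h)
    · cases k with
      | zero =>
        have h0 := degree_le_iff.1 (le_of_eq (show degree φ = 0 from h))
        intro s hs
        have := List.length_eq_zero_iff.1 (Nat.le_zero.1 (h0 s hs))
        subst this
        simp
      | succ k =>
        intro s hs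
        refine ⟨degree_le_iff.1 (le_of_eq (show degree φ = k + 1 from h.1)) s hs, fun hl => ?_⟩
        simp [h.2 s hs hl]
    · simp only [Set.mem_iUnion] at h
      obtain ⟨i, hi, h⟩ := h
      intro s hs
      have := degree_le_iff.1 (le_of_eq (show degree φ = i from h)) s hs
      exact ⟨by omega, fun hl => by omega⟩
  · intro h
    have hd : degree φ ≤ k := degree_le_iff.2 fun s hs => (h s hs).1
    rcases hd.lt_or_eq with hlt | heq
    · right
      simp only [Set.mem_iUnion]
      exact ⟨degree φ, hlt, rfl⟩
    · left
      cases k with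
      | zero => exact heq
      | succ k =>
        refine ⟨heq, fun s hs hl => ?_⟩
        cases s with
        | nil => simp at hl
        | cons a s => simpa using (h _ hs).2 hl

theorem EClass.pathBound {k : ℕ} {φ : Fml} (h : φ ∈ EClass k) : PathBound false k φ := by
  cases k with
  | zero =>
    have h0 := degree_le_iff.1 (le_of_eq (show degree φ = 0 from h))
    intro s hs
    have := List.length_eq_zero_iff.1 (Nat.le_zero.1 (h0 s hs))
    subst this
    simp
  | succ k =>
    intro s hs
    refine ⟨degree_le_iff.1 (le_of_eq (show degree φ = k + 1 from h.1)) s hs, fun hl => ?_⟩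
    simp [h.2 s hs hl]

theorem head?_map_not (s : List Bool) (b : Bool) :
    (s.map not).head? = some b ↔ s.head? = some (!b) := by
  cases s with
  | nil => simp
  | cons a s => cases a <;> cases b <;> simp

theorem PathBound.falsum (b : Bool) (k : ℕ) : PathBound b k falsum := by
  simp [PathBound, alt]

theorem pathBound_neg_iff {b : Bool} {k : ℕ} {φ : Fml} :
    PathBound b k (neg φ) ↔ PathBound (!b) k φ := by
  simp [PathBound, alt_neg]

theorem pathBound_imp_iff {b : Bool} {k : ℕ} {φ ψ : Fml} :
    PathBound b k (imp φ ψ) ↔ PathBound (!b) k φ ∧ PathBound b k ψ := by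
  by_cases h : ψ = Fml.falsum
  · subst h
    exact ⟨fun h => ⟨pathBound_neg_iff.1 h, .falsum b k⟩, fun h => pathBound_neg_iff.2 h.1⟩
  · simp only [PathBound, alt_imp_of_ne h, Finset.mem_union, or_imp, forall_and,
      Finset.forall_mem_image, List.length_map, head?_map_not, ne_eq]
    tauto

theorem pathBound_and_iff {b : Bool} {k : ℕ} {φ ψ : Fml} :
    PathBound b k (and φ ψ) ↔ PathBound b k φ ∧ PathBound b k ψ := by
  simp only [PathBound, alt, Finset.mem_union, or_imp, forall_and]
  tauto

theorem pathBound_or_iff {b : Bool} {k : ℕ} {φ ψ : Fml} :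
    PathBound b k (or φ ψ) ↔ PathBound b k φ ∧ PathBound b k ψ := by
  simp only [PathBound, alt, Finset.mem_union, or_imp, forall_and]
  tauto

/-- Both quantifiers, with the sign which they put in front of a path negated. -/
def quant : Bool → Fml → Fml
  | true => all
  | false => ex

theorem alt_quant (b : Bool) (φ : Fml) :
    alt (quant b φ) = (alt φ).image (fun s => if s.head? = some (!b) then s else (!b) :: s) := by
  cases b <;> rfl

/-- A path of maximal length `k + 1` is nonempty and does not begin with `b`, so it begins with `!b`
already and is not lengthened; a shorter path has room for one more sign. At the bound `0` this
fails, since the empty path grows. -/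
theorem pathBound_quant_iff {b : Bool} {k : ℕ} {φ : Fml} :
    PathBound b (k + 1) (quant b φ) ↔ PathBound b (k + 1) φ := by
  simp only [PathBound, alt_quant, Finset.forall_mem_image]
  refine forall₂_congr fun s _ => ?_
  by_cases h : s.head? = some (!b)
  · rw [if_pos h]
  · rw [if_neg h]
    cases s with
    | nil => simp
    | cons a s => cases a <;> cases b <;> simp_all <;> omega

/-- All paths of this quantified formula begin with `b`, which is forbidden at length `k`. Hence all
are shorter than `k`, and at the lower bound the forbidden sign may be exchanged. -/
theorem PathBound.of_quant_not {b : Bool} {k : ℕ} {φ : Fml} (h : PathBound b k (quant (!b) φ)) :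
    ∃ j, k = j + 1 ∧ PathBound (!b) j (quant (!b) φ) := by
  have hh : ∀ s ∈ alt (quant (!b) φ), s.head? = some b := by
    simp only [alt_quant, Finset.forall_mem_image, Bool.not_not]
    intro s _
    split_ifs with h
    · exact h
    · rfl
  have hlt : ∀ s ∈ alt (quant (!b) φ), s.length < k := fun s hs =>
    lt_of_le_of_ne (h s hs).1 fun hl => (h s hs).2 hl (hh s hs)
  cases k with
  | zero =>
    exfalso
    -- A formula without paths would satisfy every bound, even `0`.
    have hne : ∀ χ : Fml, (alt χ).Nonempty := by
      intro χ
      induction χ with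
      | eq s t => simp [alt]
      | falsum => simp [alt]
      | and φ ψ ih₁ ih₂ => exact ih₁.mono Finset.subset_union_left
      | or φ ψ ih₁ ih₂ => exact ih₁.mono Finset.subset_union_left
      | imp φ ψ ih₁ ih₂ =>
        by_cases h : ψ = Fml.falsum
        · subst h
          exact ih₁.image _
        · rw [alt_imp_of_ne h]
          exact (ih₁.image _).mono Finset.subset_union_left
      | all φ ih => exact ih.image _
      | ex φ ih => exact ih.image _
    obtain ⟨s, hs⟩ := hne (quant (!b) φ)
    exact Nat.not_lt_zero _ (hlt s hs)
  | succ j =>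
    refine ⟨j, rfl, fun s hs => ⟨Nat.le_of_lt_succ (hlt s hs), fun _ => ?_⟩⟩
    rw [hh s hs]
    cases b <;> simp

theorem PathBound.pos_of_quant {b : Bool} {k : ℕ} {φ : Fml} (h : PathBound b k (quant b φ)) :
    ∃ j, k = j + 1 := by
  by_contra hk
  have hk : k = 0 := by
    cases k with
    | zero => rfl
    | succ j => exact (hk ⟨j, rfl⟩).elim
  subst hk
  -- At the bound `0` only the empty path is possible, so the sign is immaterial and the previous
  -- lemma applies with the other one.
  have : PathBound (!b) 0 (quant (!(!b)) φ) := by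
    rw [Bool.not_not]
    intro s hs
    have := (h s hs).1
    have := List.length_eq_zero_iff.1 (Nat.le_zero.1 this)
    subst this
    simp
  obtain ⟨j, hj, -⟩ := this.of_quant_not
  omega

theorem PathBound.of_lt {b c : Bool} {j k : ℕ} {φ : Fml} (h : PathBound b j φ) (hjk : j < k) :
    PathBound c k φ := fun s hs =>
  ⟨(h s hs).1.trans hjk.le, fun hl => absurd (h s hs).1 (by omega)⟩

theorem PathBound.of_le {b : Bool} {j k : ℕ} {φ : Fml} (h : PathBound b j φ) (hjk : j ≤ k) :
    PathBound b k φ := by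
  rcases hjk.lt_or_eq with hlt | rfl
  · exact h.of_lt hlt
  · exact h

theorem PathBound.of_degree_le {b : Bool} {k : ℕ} {φ : Fml} (h : degree φ ≤ k) :
    PathBound b (k + 1) φ := fun s hs =>
  ⟨(degree_le_iff.1 h s hs).trans k.le_succ, fun hl => absurd (degree_le_iff.1 h s hs) (by omega)⟩

theorem Fml.QF.pathBound {φ : Fml} (h : QF φ) (b : Bool) (k : ℕ) : PathBound b k φ := by
  induction φ generalizing b with
  | eq s t => simp [PathBound, alt]
  | falsum => exact .falsum b k
  | and φ ψ ih₁ ih₂ => exact pathBound_and_iff.2 ⟨ih₁ h.1 b, ih₂ h.2 b⟩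
  | or φ ψ ih₁ ih₂ => exact pathBound_or_iff.2 ⟨ih₁ h.1 b, ih₂ h.2 b⟩
  | imp φ ψ ih₁ ih₂ => exact pathBound_imp_iff.2 ⟨ih₁ h.1 _, ih₂ h.2 b⟩
  | all φ ih => exact h.elim
  | ex φ ih => exact h.elim

theorem PathBound.qf {b : Bool} {φ : Fml} (h : PathBound b 0 φ) : QF φ := by
  induction φ generalizing b with
  | eq s t => trivial
  | falsum => trivial
  | and φ ψ ih₁ ih₂ => exact ⟨ih₁ (pathBound_and_iff.1 h).1, ih₂ (pathBound_and_iff.1 h).2⟩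
  | or φ ψ ih₁ ih₂ => exact ⟨ih₁ (pathBound_or_iff.1 h).1, ih₂ (pathBound_or_iff.1 h).2⟩
  | imp φ ψ ih₁ ih₂ => exact ⟨ih₁ (pathBound_imp_iff.1 h).1, ih₂ (pathBound_imp_iff.1 h).2⟩
  | all φ ih =>
    have h : ∀ c, PathBound c 0 (all φ) := by
      intro c s hs
      have := List.length_eq_zero_iff.1 (Nat.le_zero.1 (h s hs).1)
      subst this
      simp
    obtain ⟨j, hj⟩ := PathBound.pos_of_quant (b := true) (h true)
    omega
  | ex φ ih =>
    have h : ∀ c, PathBound c 0 (ex φ) := by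
      intro c s hs
      have := List.length_eq_zero_iff.1 (Nat.le_zero.1 (h s hs).1)
      subst this
      simp
    obtain ⟨j, hj⟩ := PathBound.pos_of_quant (b := false) (h false)
    omega

theorem all_mem_UClass (φ : Fml) : all φ ∈ UClass (degree (all φ)) := by
  have hh : ∀ s ∈ alt (all φ), s.head? = some false := by
    simp only [alt, Finset.forall_mem_image]
    intro s _
    split_ifs with h
    · exact h
    · rfl
  cases hd : degree (all φ) with
  | zero => exact hd
  | succ k => exact ⟨hd, fun s hs _ => hh s hs⟩

theorem neg_mem_EClass {k : ℕ} {φ : Fml} (h : φ ∈ UClass k) : neg φ ∈ EClass k := by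
  have hd : degree (neg φ) = degree φ := by
    refine eq_of_forall_ge_iff fun c => ?_
    simp [degree_le_iff, alt_neg]
  cases k with
  | zero => exact hd.trans h
  | succ k =>
    refine ⟨hd.trans h.1, ?_⟩
    simpa [alt_neg, head?_map_not] using h.2

/-- The classes `Π_k` (for `b = true`) and `Σ_k` (for `b = false`), by a uniform recursion. -/
inductive Prenex : Bool → ℕ → Fml → Prop
  | qf {b : Bool} {φ : Fml} : QF φ → Prenex b 0 φ
  | base {b : Bool} {k : ℕ} {φ : Fml} : Prenex (!b) k φ → Prenex b (k + 1) φ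
  | quant {b : Bool} {k : ℕ} {φ : Fml} : Prenex b (k + 1) φ → Prenex b (k + 1) (quant b φ)

theorem Prenex.iterate {b : Bool} {k : ℕ} {φ : Fml} (h : Prenex b (k + 1) φ) (n : ℕ) :
    Prenex b (k + 1) ((SemiClassical.quant b)^[n] φ) := by
  induction n with
  | zero => exact h
  | succ n ih =>
    rw [Function.iterate_succ_apply']
    exact ih.quant

theorem mem_prenexClass_iff (k : ℕ) : ∀ φ : Fml,
    (φ ∈ PiClass k ↔ Prenex true k φ) ∧ (φ ∈ SigmaClass k ↔ Prenex false k φ) := by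
  induction k with
  | zero =>
    intro φ
    simp only [PiClass, SigmaClass, Set.mem_ofPred_eq]
    exact ⟨⟨.qf, fun h => by cases h; assumption⟩, ⟨.qf, fun h => by cases h; assumption⟩⟩
  | succ k ih =>
    intro φ
    simp only [PiClass, SigmaClass, Set.mem_ofPred_eq]
    refine ⟨⟨?_, fun h => ?_⟩, ⟨?_, fun h => ?_⟩⟩
    · rintro ⟨n, ψ, hψ, rfl⟩
      exact Prenex.iterate (b := true) (.base ((ih ψ).2.1 hψ)) n
    · generalize hb : true = b at h
      generalize hj : k + 1 = j at h
      induction h with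
      | qf => omega
      | base h =>
        subst hb
        cases hj
        exact ⟨0, _, (ih _).2.2 h, rfl⟩
      | quant h ih' =>
        subst hb
        obtain ⟨n, ψ, hψ, rfl⟩ := ih' rfl hj
        exact ⟨n + 1, ψ, hψ, (Function.iterate_succ_apply' all n ψ).symm⟩
    · rintro ⟨n, ψ, hψ, rfl⟩
      exact Prenex.iterate (b := false) (.base ((ih ψ).1.1 hψ)) n
    · generalize hb : false = b at h
      generalize hj : k + 1 = j at h
      induction h with
      | qf => omega
      | base h =>
        subst hb
        cases hj
        exact ⟨0, _, (ih _).1.2 h, rfl⟩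
      | quant h ih' =>
        subst hb
        obtain ⟨n, ψ, hψ, rfl⟩ := ih' rfl hj
        exact ⟨n + 1, ψ, hψ, (Function.iterate_succ_apply' ex n ψ).symm⟩

theorem mem_PiClass_iff {k : ℕ} {φ : Fml} : φ ∈ PiClass k ↔ Prenex true k φ :=
  (mem_prenexClass_iff k φ).1

theorem quant_subst (b : Bool) (φ : Fml) (σ : ℕ → Tm) :
    (quant b φ).subst σ = quant b (φ.subst (up σ)) := by
  cases b <;> rfl

theorem quant_FV (b : Bool) (φ : Fml) : FV (quant b φ) = {n | n + 1 ∈ FV φ} := by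
  cases b <;> rfl

namespace Prenex

theorem subst {b : Bool} {k : ℕ} {φ : Fml} (h : Prenex b k φ) (σ : ℕ → Tm) :
    Prenex b k (φ.subst σ) := by
  induction h generalizing σ with
  | qf h => exact .qf (h.subst σ)
  | base _ ih => exact .base (ih σ)
  | quant _ ih =>
    rw [quant_subst]
    exact .quant (ih _)

theorem pathBound {b : Bool} {k : ℕ} {φ : Fml} (h : Prenex b k φ) : PathBound b k φ := by
  induction h with
  | qf h => exact h.pathBound _ _
  | base _ ih => exact ih.of_lt (Nat.lt_succ_self _)
  | quant _ ih => exact pathBound_quant_iff.2 ih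

theorem succ {b : Bool} {k : ℕ} {φ : Fml} (h : Prenex b k φ) : Prenex b (k + 1) φ := by
  induction h with
  | qf h => exact .base (.qf h)
  | base _ ih => exact .base ih
  | quant _ ih => exact .quant ih

theorem of_qf {φ : Fml} (h : QF φ) (b : Bool) (k : ℕ) : Prenex b k φ := by
  induction k with
  | zero => exact .qf h
  | succ k ih => exact ih.succ

end Prenex


/-! ### Natural deduction -/

namespace Derives

variable {A B : Set Fml} {Γ Δ : List Fml} {φ ψ χ α β γ δ : Fml}

theorem weaken (h : Derives A Γ φ) (hs : Γ ⊆ Δ) : Derives A Δ φ := by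
  induction h generalizing Δ with
  | ax h => exact .ax h
  | assume h => exact .assume (hs h)
  | falsumE _ ih => exact .falsumE (ih hs)
  | andI _ _ ih₁ ih₂ => exact .andI (ih₁ hs) (ih₂ hs)
  | andE₁ _ ih => exact .andE₁ (ih hs)
  | andE₂ _ ih => exact .andE₂ (ih hs)
  | orI₁ _ ih => exact .orI₁ (ih hs)
  | orI₂ _ ih => exact .orI₂ (ih hs)
  | orE _ _ _ ih₁ ih₂ ih₃ =>
    exact .orE (ih₁ hs) (ih₂ (List.cons_subset_cons _ hs)) (ih₃ (List.cons_subset_cons _ hs))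
  | impI _ ih => exact .impI (ih (List.cons_subset_cons _ hs))
  | impE _ _ ih₁ ih₂ => exact .impE (ih₁ hs) (ih₂ hs)
  | allI _ ih => exact .allI (ih (List.map_subset _ hs))
  | allE t _ ih => exact .allE t (ih hs)
  | exI t _ ih => exact .exI t (ih hs)
  | exE _ _ ih₁ ih₂ => exact .exE (ih₁ hs) (ih₂ (List.cons_subset_cons _ (List.map_subset _ hs)))

theorem mono (h : Derives A Γ φ) (hs : A ⊆ B) : Derives B Γ φ := by
  induction h with
  | ax h => exact .ax (hs h)
  | assume h => exact .assume h
  | falsumE _ ih => exact .falsumE ih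
  | andI _ _ ih₁ ih₂ => exact .andI ih₁ ih₂
  | andE₁ _ ih => exact .andE₁ ih
  | andE₂ _ ih => exact .andE₂ ih
  | orI₁ _ ih => exact .orI₁ ih
  | orI₂ _ ih => exact .orI₂ ih
  | orE _ _ _ ih₁ ih₂ ih₃ => exact .orE ih₁ ih₂ ih₃
  | impI _ ih => exact .impI ih
  | impE _ _ ih₁ ih₂ => exact .impE ih₁ ih₂
  | allI _ ih => exact .allI ih
  | allE t _ ih => exact .allE t ih
  | exI t _ ih => exact .exI t ih
  | exE _ _ ih₁ ih₂ => exact .exE ih₁ ih₂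

theorem subst (hA : ∀ φ ∈ A, ∀ σ, φ.subst σ ∈ A) (h : Derives A Γ φ) (σ : ℕ → Tm) :
    Derives A (Γ.map fun ψ => ψ.subst σ) (φ.subst σ) := by
  have hmap : ∀ (Γ : List Fml) (σ : ℕ → Tm), (Γ.map shift).map (fun ψ => ψ.subst (up σ)) =
      (Γ.map fun ψ => ψ.subst σ).map shift := by
    intro Γ σ
    simp only [List.map_map]
    exact List.map_congr_left fun ψ _ => (shift_subst ψ σ).symm
  induction h generalizing σ with
  | ax h => exact .ax (hA _ h σ)
  | assume h => exact .assume (List.mem_map_of_mem h)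
  | falsumE _ ih => exact .falsumE (ih σ)
  | andI _ _ ih₁ ih₂ => exact .andI (ih₁ σ) (ih₂ σ)
  | andE₁ _ ih => exact .andE₁ (ih σ)
  | andE₂ _ ih => exact .andE₂ (ih σ)
  | orI₁ _ ih => exact .orI₁ (ih σ)
  | orI₂ _ ih => exact .orI₂ (ih σ)
  | orE _ _ _ ih₁ ih₂ ih₃ => exact .orE (ih₁ σ) (ih₂ σ) (ih₃ σ)
  | impI _ ih => exact .impI (ih σ)
  | impE _ _ ih₁ ih₂ => exact .impE (ih₁ σ) (ih₂ σ)
  | allI _ ih =>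
    refine .allI ?_
    rw [← hmap]
    exact ih _
  | allE t _ ih =>
    rw [inst_subst]
    exact .allE _ (ih σ)
  | exI t _ ih =>
    refine .exI (t.subst σ) ?_
    rw [← inst_subst]
    exact ih σ
  | exE _ _ ih₁ ih₂ =>
    refine .exE (ih₁ σ) ?_
    rw [← hmap, shift_subst]
    exact ih₂ _

theorem as0 : Derives A (φ :: Γ) φ := .assume (.head _)
theorem as1 : Derives A (α :: φ :: Γ) φ := .assume (.tail _ (.head _))
theorem as2 : Derives A (α :: β :: φ :: Γ) φ := .assume (.tail _ (.tail _ (.head _)))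
theorem as3 : Derives A (α :: β :: γ :: φ :: Γ) φ :=
  .assume (.tail _ (.tail _ (.tail _ (.head _))))
theorem as4 : Derives A (α :: β :: γ :: δ :: φ :: Γ) φ :=
  .assume (.tail _ (.tail _ (.tail _ (.tail _ (.head _)))))

theorem cons (h : Derives A Γ φ) : Derives A (ψ :: Γ) φ := h.weaken (List.subset_cons_self _ _)

theorem closed (h : Derives A [] φ) : Derives A Γ φ := h.weaken (List.nil_subset _)

theorem cut (h : Derives A Γ φ) (h' : Derives A (φ :: Γ) ψ) : Derives A Γ ψ := .impE (.impI h') h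

theorem trans (h : Derives A Γ φ) (h' : Derives A [φ] ψ) : Derives A Γ ψ :=
  h.cut (h'.weaken (List.cons_subset_cons _ (List.nil_subset _)))

theorem imp_elim (h : Derives A Γ (imp φ ψ)) : Derives A (φ :: Γ) ψ := .impE h.cons as0

theorem dne_neg (h : Derives A Γ (neg (neg (neg φ)))) : Derives A Γ (neg φ) :=
  .impI (.impE h.cons (.impI (.impE as0 as1)))

theorem dni (h : Derives A Γ φ) : Derives A Γ (neg (neg φ)) :=
  .impI (.impE as0 h.cons)

/-- From `¬¬φ` one may pass to `φ` when the conclusion is negated. -/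
theorem dn_elim (h : Derives A Γ (neg (neg φ))) (h' : Derives A (φ :: Γ) (neg ψ)) :
    Derives A Γ (neg ψ) :=
  .impI (.impE h.cons (.impI (.impE (h'.weaken (by
    intro x hx
    rcases List.mem_cons.1 hx with rfl | hx <;> simp_all)) as1)))

theorem dn_map (h : Derives A [φ] ψ) : Derives A [neg (neg φ)] (neg (neg ψ)) :=
  as0.dn_elim ((as0.trans h).dni)

/-- The premise `∀ φ`, taken under a quantifier, can be used at the fresh variable. -/
theorem all_shift (h : Derives A Γ (all φ).shift) : Derives A Γ φ := by
  have := allE (v 0) h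
  rwa [subst_up_shift_inst] at this

/-- `∃ φ`, taken under a quantifier, follows from `φ` for the fresh variable. -/
theorem ex_shift (h : Derives A Γ φ) : Derives A Γ (ex φ).shift := by
  refine exI (v 0) ?_
  rwa [subst_up_shift_inst]

theorem all_map (h : Derives A [φ] ψ) : Derives A [all φ] (all ψ) :=
  .allI ((all_shift as0).trans h)

theorem ex_map (h : Derives A [φ] ψ) : Derives A [ex φ] (ex ψ) :=
  .exE as0 (ex_shift (as0.trans h))

end Derives

open Derives

theorem HAAxiom.subst {φ : Fml} (h : HAAxiom φ) (σ : ℕ → Tm) : HAAxiom (φ.subst σ) := by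
  have hcons : ∀ {n : ℕ} (t : Tm) (ts : Fin n → Tm),
      (fun i => (Fin.cons (α := fun _ => Tm) t ts i).subst σ) =
        Fin.cons (α := fun _ => Tm) (t.subst σ) (fun i => (ts i).subst σ) := by
    intro n t ts
    funext i
    refine Fin.cases ?_ (fun i => ?_) i <;> simp
  cases h with
  | eqRefl t => exact .eqRefl _
  | eqSubst φ s t =>
    simp only [Fml.subst, inst_subst]
    exact .eqSubst _ _ _
  | succNeZero t =>
    simp only [neg_subst, Fml.subst, zeroTm_subst, succTm_subst]
    exact .succNeZero _
  | succInj s t => exact .succInj _ _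
  | projDef i ts => exact .projDef i fun i => (ts i).subst σ
  | compDef f g ts => exact .compDef f g fun i => (ts i).subst σ
  | precZero f g ts =>
    simp only [Fml.subst, app_subst, hcons, zeroTm_subst]
    exact .precZero f g _
  | precSucc f g t ts =>
    simp only [Fml.subst, app_subst, hcons, succTm_subst]
    exact .precSucc f g _ _
  | induction φ =>
    simp only [Fml.subst, inst_subst, zeroTm_subst, succInst_subst]
    exact .induction _

theorem HA_subst (φ : Fml) (h : φ ∈ HA) (σ : ℕ → Tm) : φ.subst σ ∈ HA := HAAxiom.subst h σ

theorem PA_subst (φ : Fml) (h : φ ∈ PA) (σ : ℕ → Tm) : φ.subst σ ∈ PA := by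
  rcases h with h | ⟨ψ, rfl⟩
  · exact Or.inl (HA_subst φ h σ)
  · exact Or.inr ⟨ψ.subst σ, rfl⟩

/-- The theories are compared only on what they prove outright, so assumptions are discharged into
implications and taken back. -/
theorem Derives.transfer {A B : Set Fml} (h : ∀ φ, Proves A φ → Proves B φ) {Γ : List Fml}
    {φ : Fml} (hd : Derives A Γ φ) : Derives B Γ φ := by
  induction Γ generalizing φ with
  | nil => exact h φ hd
  | cons ψ Γ ih => exact (ih (.impI hd)).imp_elim

theorem PA_dne {Γ : List Fml} {φ : Fml} (h : Derives PA Γ (neg (neg φ))) : Derives PA Γ φ :=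
  .orE (.ax (Or.inr ⟨φ, rfl⟩)) as0 (.falsumE (.impE h.cons as0))


/-! ### Equality in intuitionistic arithmetic -/

theorem Tm.shift_single (s t : Tm) : (s.subst fun n => v (n + 1)).subst (single t) = s := by
  rw [Tm.subst_subst]
  exact Tm.subst_var s

namespace HA

variable {Γ : List Fml} {s t u : Tm}

theorem refl (t : Tm) : Derives HA Γ (eq t t) := .ax (.eqRefl t)

theorem replace (φ : Fml) (h : Derives HA Γ (eq s t)) (h' : Derives HA Γ (φ.subst (single s))) :
    Derives HA Γ (φ.subst (single t)) := by
  rw [← inst_eq] at *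
  exact .impE (.impE (.ax (.eqSubst φ s t)) h) h'

theorem symm (h : Derives HA Γ (eq s t)) : Derives HA Γ (eq t s) := by
  have := replace (eq (v 0) (s.subst fun n => v (n + 1))) h
  simp only [Fml.subst, v_subst, single_zero, Tm.shift_single] at this
  exact this (refl s)

theorem trans (h : Derives HA Γ (eq s t)) (h' : Derives HA Γ (eq t u)) :
    Derives HA Γ (eq s u) := by
  have := replace (eq (s.subst fun n => v (n + 1)) (v 0)) h'
  simp only [Fml.subst, v_subst, single_zero, Tm.shift_single] at this
  exact this h

/-- The replacement axiom treats one term at a time, so the arguments are exchanged one by one; in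
`key` the first `k` are exchanged. -/
theorem congr_app {n : ℕ} (f : PRSymbol n) {ts us : Fin n → Tm}
    (h : ∀ i, Derives HA Γ (eq (ts i) (us i))) : Derives HA Γ (eq (app f ts) (app f us)) := by
  have key : ∀ k ≤ n, Derives HA Γ
      (eq (app f ts) (app f fun i => if (i : ℕ) < k then us i else ts i)) := by
    intro k
    induction k with
    | zero => exact fun _ => by simpa using refl _
    | succ k ih =>
      intro hk
      -- The variable `0` marks the argument with index `k`; all other terms are shifted to keep it
      -- fresh.
      have := replace (eq ((app f ts).subst fun n => v (n + 1))
        (app f fun i => if (i : ℕ) < k then (us i).subst fun n => v (n + 1)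
          else if (i : ℕ) = k then v 0 else (ts i).subst fun n => v (n + 1))) (h ⟨k, hk⟩)
      simp only [Fml.subst, Tm.shift_single, app_subst] at this
      convert this ?_ using 3
      · funext i
        split_ifs with h1 h2 h3 h4
        · rw [Tm.shift_single]
        · have : i = ⟨k, hk⟩ := Fin.ext h3
          subst this
          simp
        · omega
        · omega
        · omega
        · rw [Tm.shift_single]
      · convert ih (by omega) using 3
        funext i
        split_ifs with h1 h2
        · rw [Tm.shift_single]
        · have : i = ⟨k, hk⟩ := Fin.ext h2
          subst this
          simp
        · rw [Tm.shift_single]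
  simpa using key n le_rfl

theorem congr_subst (t : Tm) {σ τ : ℕ → Tm}
    (h : ∀ i ∈ t.varFinset, Derives HA Γ (eq (σ i) (τ i))) :
    Derives HA Γ (eq (t.subst σ) (t.subst τ)) := by
  induction t with
  | var i => exact h i (by simp)
  | func f ts ih =>
    exact congr_app f fun i => ih i fun j hj => h j (by simpa using ⟨i, hj⟩)

theorem shift_eq (h : Derives HA Γ (eq s t)) : Derives HA (Γ.map shift)
    (eq (s.subst fun n => v (n + 1)) (t.subst fun n => v (n + 1))) :=
  h.subst HA_subst fun n => v (n + 1)

/-- Provably equal terms may be substituted for each other. -/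
theorem subst_of_eq (φ : Fml) {σ τ : ℕ → Tm} (h : ∀ i ∈ FV φ, Derives HA Γ (eq (σ i) (τ i)))
    (hd : Derives HA Γ (φ.subst σ)) : Derives HA Γ (φ.subst τ) := by
  have hup : ∀ {ψ : Fml} {Γ : List Fml} {σ τ : ℕ → Tm},
      (∀ i ∈ {n | n + 1 ∈ FV ψ}, Derives HA Γ (eq (σ i) (τ i))) →
      ∀ i ∈ FV ψ, Derives HA (Γ.map shift) (eq (up σ i) (up τ i)) := by
    intro ψ Γ σ τ h i hi
    cases i with
    | zero => exact refl _
    | succ i =>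
      rw [up_succ, up_succ]
      exact shift_eq (h i hi)
  induction φ generalizing σ τ Γ with
  | eq s t =>
    exact trans (symm (congr_subst s fun i hi => h i (Or.inl hi)))
      (trans hd (congr_subst t fun i hi => h i (Or.inr hi)))
  | falsum => exact hd
  | and φ ψ ih₁ ih₂ =>
    exact .andI (ih₁ (fun i hi => h i (Or.inl hi)) hd.andE₁)
      (ih₂ (fun i hi => h i (Or.inr hi)) hd.andE₂)
  | or φ ψ ih₁ ih₂ =>
    exact .orE hd (.orI₁ (ih₁ (fun i hi => (h i (Or.inl hi)).cons) as0))
      (.orI₂ (ih₂ (fun i hi => (h i (Or.inr hi)).cons) as0))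
  | imp φ ψ ih₁ ih₂ =>
    refine .impI (ih₂ (fun i hi => (h i (Or.inr hi)).cons) (.impE hd.cons ?_))
    exact ih₁ (fun i hi => symm (h i (Or.inl hi)).cons) as0
  | all φ ih =>
    refine .allI (ih (hup h) (all_shift ?_))
    exact hd.subst HA_subst fun n => v (n + 1)
  | ex φ ih =>
    exact .exE hd (ex_shift (ih (fun i hi => (hup h i hi).cons) as0))

/-- Induction on the variable with index `0`, for provable formulas with free variables. -/
theorem ind {φ : Fml} (h0 : Derives HA [] (φ.subst (SemiClassical.replace zeroTm)))
    (hs : Derives HA [φ] (φ.subst (SemiClassical.replace (succTm (v 0))))) : Derives HA [] φ := by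
  have h0' : Derives HA [] (φ.inst zeroTm) := by
    have := h0.subst HA_subst (single zeroTm)
    rw [subst_subst, List.map_nil] at this
    rw [inst_eq]
    convert this using 2
    funext n
    cases n <;> simp [compSubst]
  have hall : Derives HA [] (all φ) := by
    refine .impE (.impE (.ax (.induction φ)) h0') (.allI (.impI ?_))
    rw [succInst_eq]
    exact hs
  exact all_shift (hall.subst HA_subst fun n => v (n + 1))

theorem subst_closed {φ : Fml} (h : Derives HA [] φ) (σ : ℕ → Tm) : Derives HA Γ (φ.subst σ) :=
  (h.subst HA_subst σ).closed

/-! ### Decidability of quantifier-free formulas -/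

theorem succ_ne_zero (h : Derives HA Γ (eq (succTm t) zeroTm)) : Derives HA Γ falsum :=
  .impE (.ax (.succNeZero t)) h

theorem succ_congr (h : Derives HA Γ (eq s t)) : Derives HA Γ (eq (succTm s) (succTm t)) :=
  congr_app _ fun _ => h

theorem zero_or_succ : Derives HA [] (or (eq (v 0) zeroTm) (ex (eq (v 1) (succTm (v 0))))) := by
  refine ind (.orI₁ ?_) (.orI₂ (.exI (v 0) (refl (succTm (v 0)))))
  simpa [Fml.subst] using refl zeroTm

/-- Induction on one variable with the other universally quantified: comparing `S x` with `S z`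
needs the induction hypothesis at `z`, not at the given value. -/
theorem eq_or_ne_var : Derives HA [] (all (or (eq (v 1) (v 0)) (neg (eq (v 1) (v 0))))) := by
  refine ind (.allI ?_) (.allI ?_)
  · simp only [Fml.subst, neg_subst, v_subst, up_succ, up_zero, replace_zero, zeroTm_subst,
      List.map_nil]
    refine ind (.orI₁ ?_) (.orI₂ (.impI ?_))
    · simpa [Fml.subst] using refl zeroTm
    · simpa [Fml.subst] using succ_ne_zero (symm as0)
  · change Derives HA [all (or (eq (v 2) (v 0)) (neg (eq (v 2) (v 0))))]
      (or (eq (succTm (v 1)) (v 0)) (neg (eq (succTm (v 1)) (v 0))))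
    refine .orE zero_or_succ.closed (.orI₂ (.impI (succ_ne_zero (trans as0 as1)))) (.exE as0 ?_)
    change Derives HA [eq (v 1) (succTm (v 0)), ex (eq (v 2) (succTm (v 0))),
      all (or (eq (v 3) (v 0)) (neg (eq (v 3) (v 0))))]
      (or (eq (succTm (v 2)) (v 1)) (neg (eq (succTm (v 2)) (v 1))))
    have key : Derives HA [eq (v 1) (succTm (v 0)), ex (eq (v 2) (succTm (v 0))),
        all (or (eq (v 3) (v 0)) (neg (eq (v 3) (v 0))))]
        (or (eq (v 2) (v 0)) (neg (eq (v 2) (v 0)))) := .allE (v 0) as2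
    refine .orE key (.orI₁ (trans (succ_congr as0) (symm as1))) (.orI₂ (.impI (.impE as1 ?_)))
    exact .impE (.ax (.succInj _ _)) (trans as0 as2)

theorem eq_or_ne (s t : Tm) : Derives HA Γ (or (eq s t) (neg (eq s t))) := by
  have h : Derives HA [] (or (eq (v 1) (v 0)) (neg (eq (v 1) (v 0)))) :=
    all_shift (eq_or_ne_var.subst HA_subst fun n => v (n + 1))
  exact subst_closed (φ := or (eq (v 1) (v 0)) (neg (eq (v 1) (v 0)))) h
    fun n => match n with
      | 0 => t
      | _ + 1 => s

theorem em_of_qf {φ : Fml} (h : QF φ) : Derives HA Γ (or φ (neg φ)) := by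
  induction φ generalizing Γ with
  | eq s t => exact eq_or_ne s t
  | falsum => exact .orI₂ (.impI as0)
  | and φ ψ ih₁ ih₂ =>
    refine .orE (ih₁ h.1) (.orE (ih₂ h.2) (.orI₁ (.andI as1 as0)) ?_) ?_
    · exact .orI₂ (.impI (.impE as1 as0.andE₂))
    · exact .orI₂ (.impI (.impE as1 as0.andE₁))
  | or φ ψ ih₁ ih₂ =>
    refine .orE (ih₁ h.1) (.orI₁ (.orI₁ as0)) (.orE (ih₂ h.2) (.orI₁ (.orI₂ as0)) ?_)
    exact .orI₂ (.impI (.orE as0 (.impE as3 as0) (.impE as2 as0)))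
  | imp φ ψ ih₁ ih₂ =>
    refine .orE (ih₂ h.2) (.orI₁ (.impI as1)) (.orE (ih₁ h.1) ?_ ?_)
    · exact .orI₂ (.impI (.impE as2 (.impE as0 as1)))
    · exact .orI₁ (.impI (.falsumE (.impE as1 as0)))
  | all φ ih => exact h.elim
  | ex φ ih => exact h.elim

end HA


/-! ### Terms up to provable equality, and pairing -/

/-- Terms modulo equality derivable from `Γ`. -/
def TermModel (Γ : List Fml) : Type :=
  Quotient (⟨fun s t : Tm => Derives HA Γ (eq s t), HA.refl, HA.symm, HA.trans⟩ : Setoid Tm)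

namespace TermModel

variable {Γ : List Fml}

/-- The class of a term. -/
def mk (Γ : List Fml) (t : Tm) : TermModel Γ := Quotient.mk _ t

theorem mk_eq_mk {s t : Tm} : mk Γ s = mk Γ t ↔ Derives HA Γ (eq s t) := Quotient.eq

theorem exists_rep (a : TermModel Γ) : ∃ t, mk Γ t = a := Quotient.exists_rep a

/-- The interpretation of a function symbol in the term model. -/
noncomputable def fn {n : ℕ} (f : PRSymbol n) (as : Fin n → TermModel Γ) : TermModel Γ :=
  mk Γ (app f fun i => (exists_rep (as i)).choose)

theorem mk_app {n : ℕ} (f : PRSymbol n) (ts : Fin n → Tm) :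
    mk Γ (app f ts) = fn f fun i => mk Γ (ts i) :=
  mk_eq_mk.2 (HA.congr_app f fun i =>
    HA.symm (mk_eq_mk.1 (exists_rep (mk Γ (ts i))).choose_spec))

theorem exists_reps {n : ℕ} (as : Fin n → TermModel Γ) : ∃ ts : Fin n → Tm, as = fun i => mk Γ (ts i) :=
  ⟨fun i => (exists_rep (as i)).choose, funext fun i => (exists_rep (as i)).choose_spec.symm⟩

/-- Zero. -/
noncomputable def zero : TermModel Γ := mk Γ zeroTm

/-- Successor. -/
noncomputable def succ (a : TermModel Γ) : TermModel Γ := fn PRSymbol.succ fun _ => a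

theorem mk_zero : mk Γ zeroTm = zero := rfl

theorem mk_succ (t : Tm) : mk Γ (succTm t) = succ (mk Γ t) := mk_app _ _

theorem fn_zero (as : Fin 0 → TermModel Γ) : fn PRSymbol.zero as = zero := by
  rw [zero, zeroTm, mk_app]
  congr 1
  funext i
  exact i.elim0

theorem fn_succ (as : Fin 1 → TermModel Γ) : fn PRSymbol.succ as = succ (as 0) := by
  rw [succ]
  congr 1
  funext i
  rw [Subsingleton.elim i 0]

theorem fn_proj {n : ℕ} (i : Fin n) (as : Fin n → TermModel Γ) :
    fn (PRSymbol.proj i) as = as i := by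
  obtain ⟨ts, rfl⟩ := exists_reps as
  rw [← mk_app]
  exact mk_eq_mk.2 (.ax (.projDef i ts))

theorem fn_comp {m n : ℕ} (f : PRSymbol n) (g : Fin n → PRSymbol m) (as : Fin m → TermModel Γ) :
    fn (PRSymbol.comp f g) as = fn f fun i => fn (g i) as := by
  obtain ⟨ts, rfl⟩ := exists_reps as
  simp only [← mk_app]
  exact mk_eq_mk.2 (.ax (.compDef f g ts))

theorem mk_cons {n : ℕ} (t : Tm) (ts : Fin n → Tm) :
    (Fin.cons (mk Γ t) fun i => mk Γ (ts i) : Fin (n + 1) → TermModel Γ) =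
      fun i => mk Γ ((Fin.cons t ts : Fin (n + 1) → Tm) i) := by
  funext i
  refine Fin.cases ?_ (fun i => ?_) i <;> simp

theorem fn_prec_zero {n : ℕ} (f : PRSymbol n) (g : PRSymbol (n + 2)) (as : Fin n → TermModel Γ) :
    fn (PRSymbol.prec f g) (Fin.cons zero as) = fn f as := by
  obtain ⟨ts, rfl⟩ := exists_reps as
  rw [zero, mk_cons, ← mk_app, ← mk_app]
  exact mk_eq_mk.2 (.ax (.precZero f g ts))

theorem fn_prec_succ {n : ℕ} (f : PRSymbol n) (g : PRSymbol (n + 2)) (a : TermModel Γ)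
    (as : Fin n → TermModel Γ) :
    fn (PRSymbol.prec f g) (Fin.cons (succ a) as) =
      fn g (Fin.cons a (Fin.cons (fn (PRSymbol.prec f g) (Fin.cons a as)) as)) := by
  obtain ⟨ts, rfl⟩ := exists_reps as
  obtain ⟨t, rfl⟩ := exists_rep a
  rw [← mk_succ]
  simp only [mk_cons, ← mk_app]
  exact mk_eq_mk.2 (.ax (.precSucc f g t ts))

/-- The interpretation of a unary function symbol. -/
noncomputable def fn₁ (f : PRSymbol 1) (a : TermModel Γ) : TermModel Γ := fn f ![a]

/-- The interpretation of a binary function symbol. -/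
noncomputable def fn₂ (f : PRSymbol 2) (a b : TermModel Γ) : TermModel Γ := fn f ![a, b]

end TermModel

/-- A unary function symbol applied to a term. -/
def app₁ (f : PRSymbol 1) (s : Tm) : Tm := app f ![s]

/-- A binary function symbol applied to terms. -/
def app₂ (f : PRSymbol 2) (s t : Tm) : Tm := app f ![s, t]

@[simp] theorem app₁_subst (f : PRSymbol 1) (s : Tm) (σ : ℕ → Tm) :
    (app₁ f s).subst σ = app₁ f (s.subst σ) := by
  rw [app₁, app_subst, app₁]
  congr 1
  funext i
  fin_cases i
  rfl

@[simp] theorem app₂_subst (f : PRSymbol 2) (s t : Tm) (σ : ℕ → Tm) :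
    (app₂ f s t).subst σ = app₂ f (s.subst σ) (t.subst σ) := by
  rw [app₂, app_subst, app₂]
  congr 1
  funext i
  fin_cases i <;> rfl

namespace TermModel

variable {Γ : List Fml}

theorem mk_app₁ (f : PRSymbol 1) (s : Tm) : mk Γ (app₁ f s) = fn₁ f (mk Γ s) := by
  rw [app₁, mk_app, fn₁]
  congr 1
  funext i
  fin_cases i
  rfl

theorem mk_app₂ (f : PRSymbol 2) (s t : Tm) : mk Γ (app₂ f s t) = fn₂ f (mk Γ s) (mk Γ t) := by
  rw [app₂, mk_app, fn₂]
  congr 1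
  funext i
  fin_cases i <;> rfl

/-- Induction for equations with the free variables `0, 1, 2`. -/
theorem ind_eq (s t : Tm)
    (h0 : mk [] (s.subst (replace zeroTm)) = mk [] (t.subst (replace zeroTm)))
    (hs : mk [eq s t] s = mk [eq s t] t →
      mk [eq s t] (s.subst (replace (succTm (v 0)))) =
        mk [eq s t] (t.subst (replace (succTm (v 0)))))
    (r : ℕ → Tm) : mk Γ (s.subst r) = mk Γ (t.subst r) :=
  mk_eq_mk.2 (HA.subst_closed (HA.ind (φ := eq s t) (mk_eq_mk.1 h0)
    (mk_eq_mk.1 (hs (mk_eq_mk.2 as0)))) r)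

/-- The assignment of `a, b, c` to the variables `0, 1, 2`. -/
def assign (a b c : Tm) : ℕ → Tm
  | 0 => a
  | 1 => b
  | _ => c

end TermModel

-- A primitive recursive pairing function and its projections.

namespace PRSymbol

/-- Addition, by recursion on the first argument. -/
def add : PRSymbol 2 := prec (proj 0) (comp succ fun _ => proj 1)

/-- The characteristic function of `{0}`. -/
def isZero : PRSymbol 1 := prec (comp succ fun _ => zero) (comp zero Fin.elim0)

/-- The remainder modulo two. -/
def parity : PRSymbol 1 := prec zero (comp isZero fun _ => proj 1)

/-- The integer half. -/
def half : PRSymbol 1 := prec zero (comp add ![comp parity fun _ => proj 0, proj 1])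

/-- The iterated integer half. -/
def halves : PRSymbol 2 := prec (proj 0) (comp half fun _ => proj 1)

/-- The pairing `(a, b) ↦ 2 ^ a * (2 * b + 1) - 1`. -/
def pair : PRSymbol 2 :=
  prec (comp add fun _ => proj 0) (comp succ fun _ => comp add fun _ => proj 1)

/-- A solution `e` of the equation `pair a b = e + a`. -/
def excess : PRSymbol 2 :=
  prec (comp add fun _ => proj 0) (comp add ![comp pair ![proj 0, proj 2], proj 1])

/-- The number of ones at the end of the binary expansion of the second argument, up to the bound
given by the first one. -/
def ones : PRSymbol 2 :=
  prec (comp zero Fin.elim0) (comp add ![comp parity fun _ => comp halves ![proj 1, proj 2], proj 1])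

/-- The first projection. -/
def left : PRSymbol 1 := comp ones fun _ => proj 0

/-- The second projection. -/
def right : PRSymbol 1 := comp half fun _ => comp halves ![left, proj 0]

end PRSymbol

namespace TermModel

open _root_.SemiClassical.PRSymbol (add isZero parity half halves pair excess ones left right)

variable {Γ : List Fml} (a b c : TermModel Γ)

theorem fn_const {n : ℕ} (f : PRSymbol 1) (g : PRSymbol n) (as : Fin n → TermModel Γ) :
    fn (.comp f fun _ => g) as = fn₁ f (fn g as) := by
  rw [fn_comp, fn₁]
  congr 1
  funext i
  fin_cases i
  rfl

theorem fn_comp₂ {n : ℕ} (f : PRSymbol 2) (g h : PRSymbol n) (as : Fin n → TermModel Γ) :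
    fn (.comp f ![g, h]) as = fn₂ f (fn g as) (fn h as) := by
  rw [fn_comp, fn₂]
  congr 1
  funext i
  fin_cases i <;> rfl

theorem fn_diag {n : ℕ} (f : PRSymbol 2) (g : PRSymbol n) (as : Fin n → TermModel Γ) :
    fn (.comp f fun _ => g) as = fn₂ f (fn g as) (fn g as) := by
  rw [fn_comp, fn₂]
  congr 1
  funext i
  fin_cases i <;> rfl

theorem fn₁_succ : fn₁ PRSymbol.succ a = succ a := fn_succ _

theorem fn₁_prec_zero (f : PRSymbol 0) (g : PRSymbol 2) :
    fn₁ (.prec f g) (zero : TermModel Γ) = fn f ![] := fn_prec_zero f g ![]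

theorem fn₁_prec_succ (f : PRSymbol 0) (g : PRSymbol 2) :
    fn₁ (.prec f g) (succ a) = fn g ![a, fn₁ (.prec f g) a] := fn_prec_succ f g a ![]

theorem fn₂_prec_zero (f : PRSymbol 1) (g : PRSymbol 3) :
    fn₂ (.prec f g) zero b = fn f ![b] := fn_prec_zero f g ![b]

theorem fn₂_prec_succ (f : PRSymbol 1) (g : PRSymbol 3) :
    fn₂ (.prec f g) (succ a) b = fn g ![a, fn₂ (.prec f g) a b, b] := fn_prec_succ f g a ![b]

theorem zero_add : fn₂ add zero b = b := by
  rw [add, fn₂_prec_zero, fn_proj]; rfl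

theorem succ_add : fn₂ add (succ a) b = succ (fn₂ add a b) := by
  conv_lhs => rw [add, fn₂_prec_succ, fn_const, fn₁_succ, fn_proj]
  rfl

theorem isZero_zero : fn₁ isZero (zero : TermModel Γ) = succ zero := by
  rw [isZero, fn₁_prec_zero, fn_const, fn₁_succ, fn_zero]

theorem isZero_succ : fn₁ isZero (succ a) = zero := by
  rw [isZero, fn₁_prec_succ, fn_comp, fn_zero]

theorem parity_zero : fn₁ parity (zero : TermModel Γ) = zero := by
  rw [parity, fn₁_prec_zero, fn_zero]

theorem parity_succ : fn₁ parity (succ a) = fn₁ isZero (fn₁ parity a) := by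
  conv_lhs => rw [parity, fn₁_prec_succ, fn_const, fn_proj]
  rfl

theorem half_zero : fn₁ half (zero : TermModel Γ) = zero := by
  rw [half, fn₁_prec_zero, fn_zero]

theorem half_succ : fn₁ half (succ a) = fn₂ add (fn₁ parity a) (fn₁ half a) := by
  conv_lhs => rw [half, fn₁_prec_succ, fn_comp₂, fn_const, fn_proj, fn_proj]
  rfl

theorem halves_zero : fn₂ halves zero b = b := by
  rw [halves, fn₂_prec_zero, fn_proj]; rfl

theorem halves_succ : fn₂ halves (succ a) b = fn₁ half (fn₂ halves a b) := by
  conv_lhs => rw [halves, fn₂_prec_succ, fn_const, fn_proj]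
  rfl

theorem pair_zero : fn₂ pair zero b = fn₂ add b b := by
  rw [pair, fn₂_prec_zero, fn_diag, fn_proj]; rfl

theorem pair_succ :
    fn₂ pair (succ a) b = succ (fn₂ add (fn₂ pair a b) (fn₂ pair a b)) := by
  conv_lhs => rw [pair, fn₂_prec_succ, fn_const, fn₁_succ, fn_diag, fn_proj]
  rfl

theorem excess_zero : fn₂ excess zero b = fn₂ add b b := by
  rw [excess, fn₂_prec_zero, fn_diag, fn_proj]; rfl

theorem excess_succ :
    fn₂ excess (succ a) b = fn₂ add (fn₂ pair a b) (fn₂ excess a b) := by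
  conv_lhs => rw [excess, fn₂_prec_succ, fn_comp₂, fn_comp₂, fn_proj, fn_proj, fn_proj]
  rfl

theorem ones_zero : fn₂ ones zero b = zero := by
  rw [ones, fn₂_prec_zero, fn_comp, fn_zero]

theorem ones_succ : fn₂ ones (succ a) b =
    fn₂ add (fn₁ parity (fn₂ halves (fn₂ ones a b) b)) (fn₂ ones a b) := by
  conv_lhs => rw [ones, fn₂_prec_succ, fn_comp₂, fn_const, fn_comp₂, fn_proj, fn_proj]
  rfl

theorem left_eq : fn₁ left a = fn₂ ones a a := by
  rw [fn₁, left, fn_diag, fn_proj]; rfl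

theorem right_eq : fn₁ right a = fn₁ half (fn₂ halves (fn₁ left a) a) := by
  rw [fn₁, right, fn_const, fn_comp₂, fn_proj]; rfl

theorem add_zero : fn₂ add a zero = a := by
  obtain ⟨s, rfl⟩ := exists_rep a
  have := ind_eq (Γ := Γ) (app₂ add (v 0) zeroTm) (v 0) ?_ ?_ (assign s s s)
  · simpa [mk_app₂, mk_zero, assign] using this
  · simp [mk_app₂, mk_zero, zero_add]
  · intro ih
    simp only [mk_app₂, mk_zero] at ih
    simp [mk_app₂, mk_zero, mk_succ, succ_add, ih]

theorem add_succ : fn₂ add a (succ b) = succ (fn₂ add a b) := by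
  obtain ⟨s, rfl⟩ := exists_rep a
  obtain ⟨t, rfl⟩ := exists_rep b
  have := ind_eq (Γ := Γ) (app₂ add (v 0) (succTm (v 1))) (succTm (app₂ add (v 0) (v 1)))
    ?_ ?_ (assign s t t)
  · simpa [mk_app₂, mk_succ, assign] using this
  · simp [mk_app₂, mk_zero, mk_succ, zero_add]
  · intro ih
    simp only [mk_app₂, mk_succ] at ih
    simp [mk_app₂, mk_succ, succ_add, ih]

theorem add_assoc : fn₂ add (fn₂ add a b) c = fn₂ add a (fn₂ add b c) := by
  obtain ⟨s, rfl⟩ := exists_rep a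
  obtain ⟨t, rfl⟩ := exists_rep b
  obtain ⟨u, rfl⟩ := exists_rep c
  have := ind_eq (Γ := Γ) (app₂ add (app₂ add (v 0) (v 1)) (v 2))
    (app₂ add (v 0) (app₂ add (v 1) (v 2))) ?_ ?_ (assign s t u)
  · simpa [mk_app₂, assign] using this
  · simp [mk_app₂, mk_zero, zero_add]
  · intro ih
    simp only [mk_app₂] at ih
    simp [mk_app₂, mk_succ, succ_add, ih]

theorem parity_double : fn₁ parity (fn₂ add a a) = zero := by
  obtain ⟨s, rfl⟩ := exists_rep a
  have := ind_eq (Γ := Γ) (app₁ parity (app₂ add (v 0) (v 0))) zeroTm ?_ ?_ (assign s s s)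
  · simpa [mk_app₂, mk_app₁, mk_zero, assign] using this
  · simp [mk_app₂, mk_app₁, mk_zero, zero_add, parity_zero]
  · intro ih
    simp only [mk_app₂, mk_app₁, mk_zero] at ih
    simp [mk_app₂, mk_app₁, mk_succ, mk_zero, succ_add, add_succ, parity_succ, isZero_zero,
      isZero_succ, ih]

theorem half_double : fn₁ half (fn₂ add a a) = a := by
  obtain ⟨s, rfl⟩ := exists_rep a
  have := ind_eq (Γ := Γ) (app₁ half (app₂ add (v 0) (v 0))) (v 0) ?_ ?_ (assign s s s)
  · simpa [mk_app₂, mk_app₁, assign] using this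
  · simp [mk_app₂, mk_app₁, mk_zero, zero_add, half_zero]
  · intro ih
    simp only [mk_app₂, mk_app₁] at ih
    simp [mk_app₂, mk_app₁, mk_succ, succ_add, add_succ, parity_succ, half_succ, isZero_zero,
      parity_double, zero_add, ih]

theorem parity_succ_double : fn₁ parity (succ (fn₂ add a a)) = succ zero := by
  rw [parity_succ, parity_double, isZero_zero]

theorem half_succ_double : fn₁ half (succ (fn₂ add a a)) = a := by
  rw [half_succ, parity_double, half_double, zero_add]

theorem halves_half : fn₂ halves a (fn₁ half b) = fn₁ half (fn₂ halves a b) := by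
  obtain ⟨s, rfl⟩ := exists_rep a
  obtain ⟨t, rfl⟩ := exists_rep b
  have := ind_eq (Γ := Γ) (app₂ halves (v 0) (app₁ half (v 1)))
    (app₁ half (app₂ halves (v 0) (v 1))) ?_ ?_ (assign s t t)
  · simpa [mk_app₂, mk_app₁, assign] using this
  · simp [mk_app₂, mk_app₁, mk_zero, halves_zero]
  · intro ih
    simp only [mk_app₂, mk_app₁] at ih
    simp [mk_app₂, mk_app₁, mk_succ, halves_succ, ih]

/-- Since `pair (S a) c = 2 * pair a c + 1`, each integer half lowers the exponent by one. -/
theorem halves_pair : fn₂ halves a (fn₂ pair (fn₂ add a b) c) = fn₂ pair b c := by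
  obtain ⟨s, rfl⟩ := exists_rep a
  obtain ⟨t, rfl⟩ := exists_rep b
  obtain ⟨u, rfl⟩ := exists_rep c
  have := ind_eq (Γ := Γ) (app₂ halves (v 0) (app₂ pair (app₂ add (v 0) (v 1)) (v 2)))
    (app₂ pair (v 1) (v 2)) ?_ ?_ (assign s t u)
  · simpa [mk_app₂, assign] using this
  · simp [mk_app₂, mk_zero, halves_zero, zero_add]
  · intro ih
    simp only [mk_app₂] at ih
    simp [mk_app₂, mk_succ, halves_succ, succ_add, pair_succ, ← halves_half, half_succ_double, ih]

/-- While the bound does not exceed the exponent, every step meets an odd number and counts one. The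
induction on `a` must quantify over `b`, because `S a + b` is treated as `a + S b`. -/
theorem ones_pair_add : fn₂ ones a (fn₂ pair (fn₂ add a b) c) = a := by
  obtain ⟨s, rfl⟩ := exists_rep a
  obtain ⟨t, rfl⟩ := exists_rep b
  obtain ⟨u, rfl⟩ := exists_rep c
  have key : Derives HA [] (all (eq (app₂ ones (v 1) (app₂ pair (app₂ add (v 1) (v 0)) (v 2)))
      (v 1))) := by
    refine HA.ind (.allI (mk_eq_mk.1 ?_)) (.allI (mk_eq_mk.1 ?_))
    · simp [mk_app₂, mk_zero, ones_zero]
    · have ih : ∀ r, Derives HA ([all (eq (app₂ ones (v 1) (app₂ pair (app₂ add (v 1) (v 0)) (v 2)))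
          (v 1))].map shift) (eq (app₂ ones (v 1) (app₂ pair (app₂ add (v 1) r) (v 2))) (v 1)) := by
        intro r
        have := Derives.allE (A := HA) r (as0 (Γ := [])
          (φ := (all (eq (app₂ ones (v 1) (app₂ pair (app₂ add (v 1) (v 0)) (v 2))) (v 1))).shift))
        simpa [shift, Fml.subst, inst_eq] using this
      have ih := mk_eq_mk.2 (ih (succTm (v 0)))
      simp only [mk_app₂, mk_succ, add_succ] at ih
      simp only [app₂_subst, v_subst, up_succ, up_zero, replace_zero, replace_succ, succTm_subst,
        mk_app₂, mk_succ, succ_add, ones_succ, ih]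
      rw [← add_succ, halves_pair, pair_succ, parity_succ_double, succ_add, zero_add]
  have := HA.subst_closed (Γ := Γ) key fun n => match n with
    | 0 => s
    | _ => u
  have := mk_eq_mk.2 (by simpa [Fml.subst, inst_eq, Tm.shift_single] using Derives.allE t this)
  simpa [mk_app₂] using this

/-- Beyond the bound `a` the count stays put: after `a` halvings the even number `2 * b` remains. -/
theorem ones_pair : fn₂ ones (fn₂ add c a) (fn₂ pair a b) = a := by
  obtain ⟨s, rfl⟩ := exists_rep a
  obtain ⟨t, rfl⟩ := exists_rep b
  obtain ⟨u, rfl⟩ := exists_rep c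
  have hz : ∀ {Γ} (a b : TermModel Γ), fn₂ halves a (fn₂ pair a b) = fn₂ add b b := fun a b => by
    simpa [add_zero, pair_zero] using halves_pair a zero b
  have := ind_eq (Γ := Γ) (app₂ ones (app₂ add (v 0) (v 1)) (app₂ pair (v 1) (v 2)))
    (v 1) ?_ ?_ (assign u s t)
  · simpa [mk_app₂, assign] using this
  · simpa [mk_app₂, mk_zero, zero_add, add_zero] using
      ones_pair_add (mk [] (v 1)) zero (mk [] (v 2))
  · intro ih
    simp only [mk_app₂] at ih
    simp [mk_app₂, mk_succ, succ_add, ones_succ, ih, hz, parity_double, zero_add]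

/-- A witness for `a ≤ pair a b`. It makes the number itself a large enough bound for `ones` in the
first projection. -/
theorem pair_eq_add : fn₂ pair a b = fn₂ add (fn₂ excess a b) a := by
  obtain ⟨s, rfl⟩ := exists_rep a
  obtain ⟨t, rfl⟩ := exists_rep b
  have := ind_eq (Γ := Γ) (app₂ pair (v 0) (v 1)) (app₂ add (app₂ excess (v 0) (v 1)) (v 0))
    ?_ ?_ (assign s t t)
  · simpa [mk_app₂, assign] using this
  · simp [mk_app₂, mk_zero, pair_zero, excess_zero, add_zero]
  · intro ih
    simp only [mk_app₂] at ih
    simp [mk_app₂, mk_succ, pair_succ, excess_succ, add_succ, add_assoc, ← ih]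

theorem left_pair : fn₁ left (fn₂ pair a b) = a := by
  rw [left_eq]
  nth_rw 1 [pair_eq_add]
  rw [ones_pair]

theorem right_pair : fn₁ right (fn₂ pair a b) = b := by
  rw [right_eq, left_pair]
  have := halves_pair a zero b
  rw [add_zero, pair_zero] at this
  rw [this, half_double]

end TermModel

/-- The code of the sequence of the first `n` values of `f`. -/
def codeTm : ℕ → (ℕ → Tm) → Tm
  | 0, _ => zeroTm
  | n + 1, f => app₂ PRSymbol.pair (f 0) (codeTm n fun i => f (i + 1))

/-- The component with index `i` of a coded sequence. -/
def entryTm : ℕ → Tm → Tm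
  | 0, t => app₁ PRSymbol.left t
  | i + 1, t => entryTm i (app₁ PRSymbol.right t)

theorem entryTm_subst (i : ℕ) (t : Tm) (σ : ℕ → Tm) :
    (entryTm i t).subst σ = entryTm i (t.subst σ) := by
  induction i generalizing t with
  | zero => simp [entryTm]
  | succ i ih => simp [entryTm, ih]

theorem entryTm_congr {Γ : List Fml} (i : ℕ) {s t : Tm}
    (h : TermModel.mk Γ s = TermModel.mk Γ t) :
    TermModel.mk Γ (entryTm i s) = TermModel.mk Γ (entryTm i t) := by
  induction i generalizing s t with
  | zero => simp [entryTm, TermModel.mk_app₁, h]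
  | succ i ih => exact ih (by simp [TermModel.mk_app₁, h])

theorem entryTm_codeTm {Γ : List Fml} {i n : ℕ} (hi : i < n) (f : ℕ → Tm) :
    Derives HA Γ (eq (entryTm i (codeTm n f)) (f i)) := by
  rw [← TermModel.mk_eq_mk]
  induction i generalizing n f with
  | zero =>
    obtain ⟨n, rfl⟩ := Nat.exists_eq_succ_of_ne_zero hi.ne'
    simp [entryTm, codeTm, TermModel.mk_app₁, TermModel.mk_app₂, TermModel.left_pair]
  | succ i ih =>
    obtain ⟨n, rfl⟩ := Nat.exists_eq_succ_of_ne_zero (Nat.zero_lt_of_lt hi).ne'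
    rw [entryTm, ← ih (Nat.lt_of_succ_lt_succ hi) fun i => f (i + 1)]
    refine entryTm_congr i ?_
    rw [codeTm, TermModel.mk_app₁, TermModel.mk_app₂, TermModel.right_pair]


/-! ### Double negation shift with arbitrary parameters -/

/-- Double negation shift for `φ`, under arbitrary assumptions. -/
def HasDNS (T : Set Fml) (φ : Fml) : Prop := Derives T [all (neg (neg φ))] (neg (neg (all φ)))

theorem codeTm_subst (n : ℕ) (f : ℕ → Tm) (σ : ℕ → Tm) :
    (codeTm n f).subst σ = codeTm n fun i => (f i).subst σ := by
  induction n generalizing f with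
  | zero => simp [codeTm]
  | succ n ih => simp [codeTm, ih]

theorem varFinset_entryTm (i : ℕ) (t : Tm) : (entryTm i t).varFinset ⊆ t.varFinset := by
  induction i generalizing t with
  | zero =>
    intro x hx
    simpa [entryTm, app₁, app] using hx
  | succ i ih =>
    intro x hx
    simpa [app₁, app] using ih _ hx

/-- All parameters of `φ` are read off as entries of one coded sequence. Substitution does not
change alternation paths, so the resulting formula is in the schema; its parameter is then
instantiated with the code of the original ones. -/
theorem hasDNS_of_pathBound {T : Set Fml} (hHA : ∀ φ, Proves HA φ → Proves T φ) {k : ℕ}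
    (hD : ProvesSchema T (DNS (UPlusClass k))) {φ : Fml} (hφ : PathBound true k φ) :
    HasDNS T φ := by
  obtain ⟨n, hn⟩ := FV_bounded φ
  let σ : ℕ → Tm := fun m => match m with
    | 0 => v 0
    | i + 1 => entryTm i (v 1)
  have hFV : FV (φ.subst σ) ⊆ {0, 1} := by
    intro x hx
    obtain ⟨i, -, hx⟩ := (mem_FV_subst _ _ _).1 hx
    cases i with
    | zero => exact Or.inl (by simpa [σ, v_varFinset] using hx)
    | succ i => exact Or.inr (by simpa [v_varFinset] using varFinset_entryTm i _ hx)
  have hinst := Derives.allE (codeTm n v)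
    (hD _ ⟨φ.subst σ, mem_UPlusClass_iff.2 (hφ.subst σ), hFV, rfl⟩)
  set τ := compSubst σ (up (single (codeTm n v))) with hτ
  have hinst : Derives T []
      (imp (all (neg (neg (φ.subst τ)))) (neg (neg (all (φ.subst τ))))) := by
    rw [inst_eq] at hinst
    simpa only [Fml.subst, neg_subst, Fml.subst_subst] using hinst
  -- Decoding the code gives the variables back only up to provable equality, so `φ.subst τ` and `φ`
  -- are interderivable rather than identical.
  have heq : ∀ {Γ}, ∀ i ∈ FV φ, Derives HA Γ (eq (τ i) (v i)) := by
    intro Γ i hi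
    cases i with
    | zero => exact HA.refl _
    | succ i =>
      have : τ (i + 1) = entryTm i (codeTm n fun i => v (i + 1)) := by
        simp [hτ, compSubst, σ, entryTm_subst, codeTm_subst]
      rw [this]
      exact entryTm_codeTm (Nat.lt_of_succ_lt (hn _ hi)) _
  have h₁ : Derives T [φ.subst τ] φ := by
    refine Derives.transfer hHA ?_
    have := HA.subst_of_eq φ heq (as0 (Γ := []))
    rwa [Fml.subst_var] at this
  have h₂ : Derives T [φ] (φ.subst τ) := by
    refine Derives.transfer hHA (HA.subst_of_eq φ (fun i hi => HA.symm (heq i hi)) ?_)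
    rw [Fml.subst_var]
    exact as0
  exact ((Derives.impE hinst.closed (all_map (dn_map h₂))).trans (dn_map (all_map h₁)))

/-! ### Equivalence and equivalence under double negation -/

/-- Derivable equivalence. -/
def Equi (T : Set Fml) (φ ψ : Fml) : Prop := Derives T [φ] ψ ∧ Derives T [ψ] φ

/-- Derivable equivalence of the double negations. -/
def DNEqui (T : Set Fml) (φ ψ : Fml) : Prop :=
  Derives T [φ] (neg (neg ψ)) ∧ Derives T [ψ] (neg (neg φ))

variable {T : Set Fml} {φ ψ χ φ' ψ' : Fml}

namespace Equi

theorem refl (φ : Fml) : Equi T φ φ := ⟨as0, as0⟩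

theorem trans (h : Equi T φ ψ) (h' : Equi T ψ χ) : Equi T φ χ :=
  ⟨h.1.trans h'.1, h'.2.trans h.2⟩

theorem dn (h : Equi T φ ψ) : DNEqui T φ ψ := ⟨h.1.dni, h.2.dni⟩

theorem and_comm (φ ψ : Fml) : Equi T (and φ ψ) (and ψ φ) :=
  ⟨.andI as0.andE₂ as0.andE₁, .andI as0.andE₂ as0.andE₁⟩

theorem quant_congr (b : Bool) (h : Equi T φ ψ) : Equi T (quant b φ) (quant b ψ) := by
  cases b
  · exact ⟨ex_map h.1, ex_map h.2⟩
  · exact ⟨all_map h.1, all_map h.2⟩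

theorem quant_and (b : Bool) (φ ψ : Fml) :
    Equi T (quant b (and φ ψ.shift)) (and (quant b φ) ψ) := by
  cases b
  · refine ⟨.exE as0 (.andI (ex_shift as0.andE₁) as0.andE₂), ?_⟩
    exact .exE as0.andE₁ (ex_shift (.andI as0 (Derives.andE₂ (φ := (ex φ).shift) as1)))
  · refine ⟨.andI (all_map as0.andE₁) ?_, ?_⟩
    -- The quantified variable does not occur in `ψ.shift`, so any instance returns `ψ`; `0` serves.
    · have := Derives.allE zeroTm (as0 (A := T) (Γ := []) (φ := all (and φ ψ.shift)))
      have := Derives.andE₂ (φ := φ.inst zeroTm) (ψ := ψ.shift.inst zeroTm) this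
      rwa [shift_inst] at this
    · exact .allI (.andI (all_shift (Derives.andE₁ (ψ := ψ.shift) as0))
        (Derives.andE₂ (φ := (all φ).shift) as0))

end Equi

namespace DNEqui

theorem symm (h : DNEqui T φ ψ) : DNEqui T ψ φ := ⟨h.2, h.1⟩

theorem trans (h : DNEqui T φ ψ) (h' : DNEqui T ψ χ) : DNEqui T φ χ :=
  ⟨h.1.dn_elim (as0.trans h'.1), h'.2.dn_elim (as0.trans h.2)⟩

theorem and_congr (h : DNEqui T φ φ') (h' : DNEqui T ψ ψ') :
    DNEqui T (and φ ψ) (and φ' ψ') := by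
  have key : ∀ {φ ψ φ' ψ' : Fml}, Derives T [φ] (neg (neg φ')) → Derives T [ψ] (neg (neg ψ')) →
      Derives T [and φ ψ] (neg (neg (and φ' ψ'))) := fun h h' =>
    (as0.andE₁.trans h).dn_elim ((as1.andE₂.trans h').dn_elim (Derives.andI as1 as0).dni)
  exact ⟨key h.1 h'.1, key h.2 h'.2⟩

theorem neg_congr (h : DNEqui T φ ψ) : DNEqui T (neg φ) (neg ψ) := by
  have key : ∀ {φ ψ : Fml}, Derives T [φ] (neg (neg ψ)) →
      Derives T [neg ψ] (neg (neg (neg φ))) := fun h =>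
    (Derives.impI (.impE (as0.trans h) as1)).dni
  exact ⟨key h.2, key h.1⟩

theorem ex_congr (h : DNEqui T φ ψ) : DNEqui T (ex φ) (ex ψ) := by
  have key : ∀ {φ ψ : Fml}, Derives T [φ] (neg (neg ψ)) →
      Derives T [ex φ] (neg (neg (ex ψ))) := fun {φ ψ} h =>
    .exE as0 ((as0.trans h).dn_elim (ψ := neg (ex ψ).shift) (ex_shift as0).dni)
  exact ⟨key h.1, key h.2⟩

/-- The only congruence here that is not purely intuitionistic: the double negation has to be moved
out of the quantifier, in each direction for the respective target. -/
theorem all_congr (h : DNEqui T φ ψ) (hφ : HasDNS T φ) (hψ : HasDNS T ψ) :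
    DNEqui T (all φ) (all ψ) :=
  ⟨(all_map h.1).trans hψ, (all_map h.2).trans hφ⟩

theorem or_equi (φ ψ : Fml) : DNEqui T (or φ ψ) (neg (and (neg φ) (neg ψ))) := by
  refine ⟨Derives.dni (.impI (.orE as1 ?_ ?_)), .impI (.impE as1 (.andI ?_ ?_))⟩
  · exact .impE (Derives.andE₁ as1) as0
  · exact .impE (Derives.andE₂ as1) as0
  · exact .impI (.impE as1 (.orI₁ as0))
  · exact .impI (.impE as1 (.orI₂ as0))

theorem imp_equi (φ ψ : Fml) : DNEqui T (imp φ ψ) (neg (and φ (neg ψ))) := by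
  refine ⟨Derives.dni (.impI (.impE as0.andE₂ (.impE as1 as0.andE₁))), .impI ?_⟩
  refine .impE as0 (.impI (.falsumE (.impE as2 (.andI as0 (.impI (.impE as2 ?_))))))
  exact .impI as1

theorem not_all (h : HasDNS T φ) : DNEqui T (neg (all φ)) (ex (neg φ)) := by
  constructor
  · refine .impI (.impE (Derives.trans (.allI (.impI ?_)) h) as1)
    exact .impE as1 (ex_shift as0)
  · refine .exE as0 (Derives.dni (.impI ?_))
    exact .impE as1 (all_shift as0)

theorem not_ex (φ : Fml) : DNEqui T (neg (ex φ)) (all (neg φ)) := by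
  refine Equi.dn ⟨.allI (.impI (.impE as1 (ex_shift as0))), .impI (.exE as0 ?_)⟩
  exact .impE (all_shift as2) as0

end DNEqui

theorem hasDNS_neg (φ : Fml) : HasDNS T (neg φ) := (all_map as0.dne_neg).dni

/-! ### Prenex normal forms under double negation -/

/-- Induction on the outermost quantifier block alone, with the level fixed. -/
theorem Prenex.block_induction {b : Bool} {k : ℕ} {P : Fml → Prop} (h : Prenex b (k + 1) φ)
    (hbase : ∀ φ, Prenex (!b) k φ → P φ)
    (hquant : ∀ φ, Prenex b (k + 1) φ → P φ → P (SemiClassical.quant b φ)) : P φ := by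
  generalize hj : k + 1 = j at h
  induction h with
  | qf => omega
  | base h =>
    cases hj
    exact hbase _ h
  | quant h ih =>
    cases hj
    exact hquant _ h (ih hbase hquant rfl)

/-- Both quantifiers move out of a conjunction intuitionistically. The two outer blocks are pulled
out in turn, merging into one, before the level drops; so the class is kept. -/
theorem Prenex.exists_and (T : Set Fml) {b : Bool} {k : ℕ} (hφ : Prenex b k φ)
    (hψ : Prenex b k ψ) :
    ∃ χ, Prenex b k χ ∧ FV χ = FV φ ∪ FV ψ ∧ Equi T χ (and φ ψ) := by
  induction k generalizing b φ ψ with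
  | zero =>
    cases hφ with
    | qf hφ =>
      cases hψ with
      | qf hψ => exact ⟨and φ ψ, .qf ⟨hφ, hψ⟩, rfl, .refl _⟩
  | succ k ih =>
    refine hφ.block_induction (P := fun φ => ∀ ψ, Prenex b (k + 1) ψ →
      ∃ χ, Prenex b (k + 1) χ ∧ FV χ = FV φ ∪ FV ψ ∧ Equi T χ (and φ ψ)) ?_ ?_ ψ hψ
    · intro φ hφ ψ hψ
      -- The block of `φ` is exhausted; now that of `ψ` is pulled out, with `φ` general because it
      -- gets shifted.
      refine hψ.block_induction (P := fun ψ => ∀ φ, Prenex (!b) k φ →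
        ∃ χ, Prenex b (k + 1) χ ∧ FV χ = FV φ ∪ FV ψ ∧ Equi T χ (and φ ψ)) ?_ ?_ φ hφ
      · intro ψ hψ φ hφ
        obtain ⟨χ, h₁, h₂, h₃⟩ := ih hφ hψ
        exact ⟨χ, h₁.base, h₂, h₃⟩
      · intro ψ _ ihψ φ hφ
        obtain ⟨χ, h₁, h₂, h₃⟩ := ihψ φ.shift (hφ.subst _)
        refine ⟨_, h₁.quant, ?_, ?_⟩
        · ext n
          simp [quant_FV, h₂, succ_mem_FV_shift]
        · exact (Equi.quant_congr b (h₃.trans (.and_comm _ _))).trans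
            ((Equi.quant_and b ψ φ).trans (.and_comm _ _))
    · intro φ _ ihφ ψ hψ
      obtain ⟨χ, h₁, h₂, h₃⟩ := ihφ ψ.shift (hψ.subst _)
      refine ⟨_, h₁.quant, ?_, (Equi.quant_congr b h₃).trans (.quant_and b φ ψ)⟩
      ext n
      simp [quant_FV, h₂, succ_mem_FV_shift]

theorem Prenex.exists_neg {K : ℕ} (hD : ∀ φ, PathBound true K φ → HasDNS T φ) 
    {b : Bool} {k : ℕ} (hk : k ≤ K) (hφ : Prenex b k φ) :
    ∃ χ, Prenex (!b) k χ ∧ FV χ = FV φ ∧ DNEqui T χ (neg φ) := by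
  induction k generalizing b φ with
  | zero =>
    cases hφ with
    | qf hφ => exact ⟨neg φ, .qf ⟨hφ, trivial⟩, FV_neg φ, (Equi.refl _).dn⟩
  | succ k ih =>
    refine hφ.block_induction (P := fun φ =>
      ∃ χ, Prenex (!b) (k + 1) χ ∧ FV χ = FV φ ∧ DNEqui T χ (neg φ)) ?_ ?_
    · intro φ hφ
      obtain ⟨χ, h₁, h₂, h₃⟩ := ih (by omega) hφ
      exact ⟨χ, h₁.base, h₂, h₃⟩
    · rintro φ hφ ⟨χ, h₁, h₂, h₃⟩
      refine ⟨_, h₁.quant, by simp [quant_FV, h₂], ?_⟩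
      cases b
      · exact (h₃.all_congr (hD _ (h₁.pathBound.of_le hk)) (hasDNS_neg φ)).trans
          (DNEqui.not_ex φ).symm
      · exact h₃.ex_congr.trans (DNEqui.not_all (hD _ (hφ.pathBound.of_le hk))).symm

theorem exists_prenex_neg_and_neg {K : ℕ} (hD : ∀ φ, PathBound true K φ → HasDNS T φ) 
    {b : Bool} {k : ℕ} (hk : k ≤ K) (hφ : Prenex (!b) k φ)
    (hψ : Prenex (!b) k ψ) :
    ∃ χ, Prenex b k χ ∧ FV χ = FV φ ∪ FV ψ ∧ DNEqui T χ (neg (and φ ψ)) := by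
  obtain ⟨χ, h₁, h₂, h₃⟩ := hφ.exists_and T hψ
  obtain ⟨χ', h₁', h₂', h₃'⟩ := h₁.exists_neg hD hk
  rw [Bool.not_not] at h₁'
  exact ⟨χ', h₁', h₂'.trans h₂, h₃'.trans h₃.dn.neg_congr⟩

/-- Induction on the formula for both signs at once, as implications exchange them. The bound `K`
covers every universal formula that arises, on either side, so the shift is always available where
`∀` is crossed. -/
theorem PathBound.exists_prenex {K : ℕ} (hD : ∀ φ, PathBound true K φ → HasDNS T φ) 
    {b : Bool} {k : ℕ} (hk : k ≤ K) (h : PathBound b k φ) :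
    ∃ χ, Prenex b k χ ∧ FV χ = FV φ ∧ DNEqui T χ φ := by
  have hquant : ∀ (c : Bool) (φ : Fml), (∀ {b : Bool} {k : ℕ}, k ≤ K → PathBound b k φ →
      ∃ χ, Prenex b k χ ∧ FV χ = FV φ ∧ DNEqui T χ φ) → ∀ {b : Bool} {k : ℕ}, k ≤ K →
      PathBound b k (quant c φ) →
      ∃ χ, Prenex b k χ ∧ FV χ = FV (quant c φ) ∧ DNEqui T χ (quant c φ) := by
    intro c φ ih
    have hc : ∀ {k : ℕ}, k ≤ K → PathBound c k (quant c φ) →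
        ∃ χ, Prenex c k χ ∧ FV χ = FV (quant c φ) ∧ DNEqui T χ (quant c φ) := by
      intro k hk h
      obtain ⟨j, rfl⟩ := h.pos_of_quant
      have h := pathBound_quant_iff.1 h
      obtain ⟨χ, h₁, h₂, h₃⟩ := ih hk h
      refine ⟨_, h₁.quant, by simp [quant_FV, h₂], ?_⟩
      cases c
      · exact h₃.ex_congr
      · exact h₃.all_congr (hD _ (h₁.pathBound.of_le hk)) (hD _ (h.of_le hk))
    intro b k hk h
    by_cases hb : b = c
    · subst hb
      exact hc hk h
    -- A quantifier of the other sign puts the formula into the dual class one level below, which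
    -- embeds as a prenex class with empty outer block.
    · obtain rfl : c = !b := by cases b <;> cases c <;> simp_all
      obtain ⟨j, rfl, h'⟩ := h.of_quant_not
      obtain ⟨χ, h₁, h₂, h₃⟩ := hc (by omega) h'
      exact ⟨χ, h₁.base, h₂, h₃⟩
  induction φ generalizing b k with
  | eq s t => exact ⟨_, .of_qf (φ := eq s t) trivial b k, rfl, (Equi.refl _).dn⟩
  | falsum => exact ⟨_, .of_qf (φ := Fml.falsum) trivial b k, rfl, (Equi.refl _).dn⟩
  | and φ ψ ih₁ ih₂ =>
    obtain ⟨h, h'⟩ := pathBound_and_iff.1 h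
    obtain ⟨φ', h₁, h₂, h₃⟩ := ih₁ hk h
    obtain ⟨ψ', h₁', h₂', h₃'⟩ := ih₂ hk h'
    obtain ⟨χ, g₁, g₂, g₃⟩ := h₁.exists_and T h₁'
    exact ⟨χ, g₁, by rw [g₂, h₂, h₂']; rfl, g₃.dn.trans (h₃.and_congr h₃')⟩
  | or φ ψ ih₁ ih₂ =>
    obtain ⟨h, h'⟩ := pathBound_or_iff.1 h
    obtain ⟨φ', h₁, h₂, h₃⟩ := ih₁ hk h
    obtain ⟨ψ', h₁', h₂', h₃'⟩ := ih₂ hk h'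
    obtain ⟨φ'', e₁, e₂, e₃⟩ := h₁.exists_neg hD hk
    obtain ⟨ψ'', e₁', e₂', e₃'⟩ := h₁'.exists_neg hD hk
    obtain ⟨χ, g₁, g₂, g₃⟩ := exists_prenex_neg_and_neg hD hk e₁ e₁'
    refine ⟨χ, g₁, by rw [g₂, e₂, e₂', h₂, h₂']; rfl, g₃.trans (.trans ?_ (DNEqui.or_equi φ ψ).symm)⟩
    exact ((e₃.trans h₃.neg_congr).and_congr (e₃'.trans h₃'.neg_congr)).neg_congr
  | imp φ ψ ih₁ ih₂ =>
    obtain ⟨h, h'⟩ := pathBound_imp_iff.1 h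
    obtain ⟨φ', h₁, h₂, h₃⟩ := ih₁ hk h
    obtain ⟨ψ', h₁', h₂', h₃'⟩ := ih₂ hk h'
    obtain ⟨ψ'', e₁', e₂', e₃'⟩ := h₁'.exists_neg hD hk
    obtain ⟨χ, g₁, g₂, g₃⟩ := exists_prenex_neg_and_neg hD hk h₁ e₁'
    refine ⟨χ, g₁, by rw [g₂, e₂', h₂, h₂']; rfl, g₃.trans (.trans ?_ (DNEqui.imp_equi φ ψ).symm)⟩
    exact (h₃.and_congr (e₃'.trans h₃'.neg_congr)).neg_congr
  | all φ ih => exact hquant true φ ih hk h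
  | ex φ ih => exact hquant false φ ih hk h

/-- A negated formula is stable, so equivalence under double negation becomes equivalence with
`¬¬χ`. -/
theorem PNFT_neg_EClass (hHA : ∀ φ, Proves HA φ → Proves T φ) {k : ℕ}
    (hD : ProvesSchema T (DNS (UPlusClass k))) {k' : ℕ} (hk : k' ≤ k) :
    PNFT T (negClass (EClass k')) (dnegClass (PiClass k')) := by
  rintro _ ⟨φ, hφ, rfl⟩
  have hb : PathBound true k' (neg φ) := pathBound_neg_iff.2 (EClass.pathBound hφ)
  obtain ⟨χ, h₁, h₂, h₃⟩ := hb.exists_prenex (fun ψ hψ => hasDNS_of_pathBound hHA hD hψ) hk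
  refine ⟨_, ⟨χ, mem_PiClass_iff.2 h₁, rfl⟩, by simp [h₂], .andI (.impI h₃.2) (.impI ?_)⟩
  exact as0.dn_elim (as0.trans h₃.1.dne_neg)


/-! ### The negative translation relative to a formula -/

namespace Fml

/-- The double negation relative to `R`. -/
def relDN (R φ : Fml) : Fml := imp (imp φ R) R

/-- The negative translation relative to `R`: falsity becomes `R`, and equations, disjunctions and
existential formulas are prefixed by a double negation relative to `R`. -/
def tr : Fml → Fml → Fml
  | R, eq s t => relDN R (eq s t)
  | R, falsum => R
  | R, and φ ψ => and (tr R φ) (tr R ψ)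
  | R, or φ ψ => relDN R (or (tr R φ) (tr R ψ))
  | R, imp φ ψ => imp (tr R φ) (tr R ψ)
  | R, all φ => all (tr R.shift φ)
  | R, ex φ => relDN R (ex (tr R.shift φ))

theorem tr_subst (R φ : Fml) (σ : ℕ → Tm) :
    (tr R φ).subst σ = tr (R.subst σ) (φ.subst σ) := by
  induction φ generalizing R σ with
  | eq s t => rfl
  | falsum => rfl
  | and φ ψ ih₁ ih₂ => simp only [tr, subst, ih₁, ih₂]
  | or φ ψ ih₁ ih₂ => simp only [tr, relDN, subst, ih₁, ih₂]
  | imp φ ψ ih₁ ih₂ => simp only [tr, subst, ih₁, ih₂]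
  | all φ ih => simp only [tr, subst, ih, shift_subst]
  | ex φ ih => simp only [tr, relDN, subst, ih, shift_subst]

theorem tr_shift (R φ : Fml) : (tr R φ).shift = tr R.shift φ.shift := tr_subst _ _ _

theorem tr_inst (R φ : Fml) (t : Tm) : (tr R.shift φ).inst t = tr R (φ.inst t) := by
  rw [inst_eq, tr_subst, ← inst_eq, ← inst_eq, shift_inst]

theorem tr_succInst (R φ : Fml) : (tr R.shift φ).succInst = tr R.shift φ.succInst := by
  rw [succInst_eq, tr_subst, ← succInst_eq, ← succInst_eq, shift_succInst]

end Fml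

variable {A : Set Fml} {Γ : List Fml} {R φ ψ : Fml}

theorem relDN_intro (h : Derives A Γ φ) : Derives A Γ (relDN R φ) := .impI (.impE as0 h.cons)

theorem relDN_elim (h : Derives A Γ (relDN R φ)) (h' : Derives A (φ :: Γ) R) : Derives A Γ R :=
  .impE h (.impI h')

/-- Translations are stable relative to `R`. This is what allows the guarded `∨` and `∃` to be
eliminated: the goal is first reduced to `R`. -/
theorem tr_of_relDN (h : Derives A Γ (relDN R (tr R φ))) : Derives A Γ (tr R φ) := by
  induction φ generalizing Γ R with
  | eq s t => exact .impI (.impE h.cons (.impI (.impE as0 as1)))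
  | falsum => exact .impE h (.impI as0)
  | and φ ψ ih₁ ih₂ =>
    exact .andI (ih₁ (.impI (.impE h.cons (.impI (.impE as1 as0.andE₁)))))
      (ih₂ (.impI (.impE h.cons (.impI (.impE as1 as0.andE₂)))))
  | or φ ψ ih₁ ih₂ => exact .impI (.impE h.cons (.impI (.impE as0 as1)))
  | imp φ ψ ih₁ ih₂ =>
    exact .impI (ih₂ (.impI (.impE h.cons.cons (.impI (.impE as1 (.impE as0 as2))))))
  | all φ ih =>
    refine Derives.cut h (.allI (ih (.impI ?_)))
    have : Derives A (imp (tr R.shift φ) R.shift :: (relDN R (all (tr R.shift φ)) :: Γ).map shift)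
        (imp (imp (all (tr R.shift φ)).shift R.shift) R.shift) := as1
    exact .impE this (.impI (.impE as1 (all_shift as0)))
  | ex φ ih => exact .impI (.impE h.cons (.impI (.impE as0 as1)))

theorem tr_of_self (h : Derives A Γ R) : Derives A Γ (tr R φ) := tr_of_relDN (.impI h.cons)

theorem tr_HAAxiom (h : HAAxiom φ) (R : Fml) : Derives HA Γ (tr R φ) := by
  cases h with
  | eqRefl t => exact relDN_intro (HA.refl t)
  | eqSubst φ s t =>
    -- Replacement for the translated formula; the guard on the equation is removed because
    -- stability turns the goal into `R`.
    have := Derives.ax (Γ := [eq s t, imp (tr R (φ.inst t)) R, tr R (φ.inst s),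
      relDN R (eq s t)] ++ Γ) (show _ ∈ HA from HAAxiom.eqSubst (tr R.shift φ) s t)
    rw [tr_inst, tr_inst] at this
    exact .impI (.impI (tr_of_relDN (.impI (relDN_elim as2
      (.impE as1 (.impE (.impE this as0) as2))))))
  | succNeZero t =>
    exact .impI (relDN_elim as0 (.falsumE (.impE (.ax (.succNeZero t)) as0)))
  | succInj s t =>
    exact .impI (.impI (relDN_elim as1 (.impE as1 (.impE (.ax (.succInj s t)) as0))))
  | projDef i ts => exact relDN_intro (.ax (.projDef i ts))
  | compDef f g ts => exact relDN_intro (.ax (.compDef f g ts))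
  | precZero f g ts => exact relDN_intro (.ax (.precZero f g ts))
  | precSucc f g t ts => exact relDN_intro (.ax (.precSucc f g t ts))
  | induction φ =>
    have := Derives.ax (Γ := Γ) (show _ ∈ HA from HAAxiom.induction (tr R.shift φ))
    rwa [tr_inst, tr_succInst] at this

theorem map_shift_map_tr (Γ : List Fml) (R : Fml) :
    (Γ.map shift).map (tr R.shift) = (Γ.map (tr R)).map shift := by
  simp only [List.map_map]
  exact List.map_congr_left fun φ _ => (tr_shift R φ).symm

/-- The translation relative to any formula turns classical into intuitionistic derivations. -/
theorem Derives.tr (h : Derives PA Γ φ) (R : Fml) : Derives HA (Γ.map (Fml.tr R)) (Fml.tr R φ) := by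
  induction h generalizing R with
  | ax h =>
    rcases h with h | ⟨φ, rfl⟩
    · exact tr_HAAxiom h R
    · exact .impI (.impE as0 (.orI₂ (.impI (.impE as1 (.orI₁ as0)))))
  | assume h => exact .assume (List.mem_map_of_mem h)
  | falsumE _ ih => exact tr_of_self (ih R)
  | andI _ _ ih₁ ih₂ => exact .andI (ih₁ R) (ih₂ R)
  | andE₁ _ ih => exact .andE₁ (ih R)
  | andE₂ _ ih => exact .andE₂ (ih R)
  | orI₁ _ ih => exact relDN_intro (.orI₁ (ih R))
  | orI₂ _ ih => exact relDN_intro (.orI₂ (ih R))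
  | orE _ _ _ ih₁ ih₂ ih₃ =>
    refine tr_of_relDN (.impI (relDN_elim (ih₁ R).cons (.orE as0 ?_ ?_)))
    · exact .impE as2 ((ih₂ R).weaken (List.cons_subset_cons _ fun x hx => by simp [hx]))
    · exact .impE as2 ((ih₃ R).weaken (List.cons_subset_cons _ fun x hx => by simp [hx]))
  | impI _ ih => exact .impI (ih R)
  | impE _ _ ih₁ ih₂ => exact .impE (ih₁ R) (ih₂ R)
  | allI _ ih =>
    refine .allI ?_
    rw [← map_shift_map_tr]
    exact ih _
  | allE t _ ih =>
    rw [← tr_inst]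
    exact .allE t (ih R)
  | exI t _ ih =>
    refine relDN_intro (.exI t ?_)
    rw [tr_inst]
    exact ih R
  | @exE Γ φ ψ _ _ ih₁ ih₂ =>
    refine tr_of_relDN (.impI (relDN_elim (ih₁ R).cons (.exE as0 ?_)))
    have h := ih₂ R.shift
    rw [List.map_cons, map_shift_map_tr, ← tr_shift] at h
    refine .impE (φ := (Fml.tr R ψ).shift) as2 (h.weaken (List.cons_subset_cons _ fun x hx => ?_))
    simp only [List.map_cons, List.mem_cons]
    exact Or.inr (Or.inr hx)

/-! ### Conservation of excluded middle -/

/-- The law of excluded middle for formulas of degree at most `j`. -/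
def LEM (j : ℕ) : Set Fml := {χ | ∃ φ, degree φ ≤ j ∧ χ = or φ (neg φ)}

theorem degree_and_le_iff {j : ℕ} :
    degree (and φ ψ) ≤ j ↔ degree φ ≤ j ∧ degree ψ ≤ j := by
  simp only [degree_le_iff, alt, Finset.mem_union, or_imp, forall_and]

theorem degree_or_le_iff {j : ℕ} :
    degree (or φ ψ) ≤ j ↔ degree φ ≤ j ∧ degree ψ ≤ j := by
  simp only [degree_le_iff, alt, Finset.mem_union, or_imp, forall_and]

theorem degree_neg (φ : Fml) : degree (neg φ) = degree φ := by
  refine eq_of_forall_ge_iff fun c => ?_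
  simp [degree_le_iff, alt_neg]

theorem degree_imp_le_iff {j : ℕ} :
    degree (imp φ ψ) ≤ j ↔ degree φ ≤ j ∧ degree ψ ≤ j := by
  by_cases h : ψ = falsum
  · subst h
    rw [← neg, degree_neg]
    simp [degree_le_iff, alt]
  · simp only [degree_le_iff, alt_imp_of_ne h, Finset.mem_union, or_imp, forall_and,
      Finset.forall_mem_image, List.length_map]

theorem degree_le_of_quant {j : ℕ} (b : Bool) (h : degree (quant b φ) ≤ j) : degree φ ≤ j := by
  simp only [degree_le_iff, alt_quant, Finset.forall_mem_image] at h ⊢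
  intro s hs
  have := h hs
  split_ifs at this
  · exact this
  · exact (Nat.le_succ _).trans this

/-- Excluded middle for `∀ φ` thus comes with excluded middle for `∃ ¬φ`, from which counterexamples
are extracted. -/
theorem degree_ex_neg (φ : Fml) : degree (ex (neg φ)) = degree (all φ) := by
  refine eq_of_forall_ge_iff fun c => ?_
  simp only [degree_le_iff, alt, alt_neg, Finset.forall_mem_image, head?_map_not, Bool.not_true]
  refine forall₂_congr fun s _ => ?_
  split_ifs <;> simp

theorem em_of_degree_le {j : ℕ} (h : degree φ ≤ j) : Derives (HA ∪ LEM j) Γ (or φ (neg φ)) :=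
  .ax (Or.inr ⟨φ, h, rfl⟩)

/-- With excluded middle for its subformulas, `φ` translates to `φ ∨ R`. -/
theorem tr_equi_of_degree_le {j : ℕ} (h : degree φ ≤ j) (R : Fml) :
    Derives (HA ∪ LEM j) [φ] (tr R φ) ∧ Derives (HA ∪ LEM j) [tr R φ] (or φ R) := by
  induction φ generalizing R with
  | eq s t =>
    refine ⟨relDN_intro as0, .orE (em_of_degree_le h) (.orI₁ as0) (.orI₂ ?_)⟩
    exact relDN_elim as1 (.falsumE (.impE as1 as0))
  | falsum => exact ⟨.falsumE as0, .orI₂ as0⟩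
  | and φ ψ ih₁ ih₂ =>
    obtain ⟨h₁, h₂⟩ := degree_and_le_iff.1 h
    refine ⟨.andI (as0.andE₁.trans (ih₁ h₁ R).1) (as0.andE₂.trans (ih₂ h₂ R).1), ?_⟩
    refine .orE (as0.andE₁.trans (ih₁ h₁ R).2) ?_ (.orI₂ as0)
    exact .orE (as1.andE₂.trans (ih₂ h₂ R).2) (.orI₁ (.andI as1 as0)) (.orI₂ as0)
  | or φ ψ ih₁ ih₂ =>
    obtain ⟨h₁, h₂⟩ := degree_or_le_iff.1 h
    refine ⟨relDN_intro (.orE as0 (.orI₁ (as0.trans (ih₁ h₁ R).1))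
      (.orI₂ (as0.trans (ih₂ h₂ R).1))), ?_⟩
    refine .orE (em_of_degree_le h) (.orI₁ as0) (.orI₂ (relDN_elim as1 (.orE as0 ?_ ?_)))
    · exact .orE (as0.trans (ih₁ h₁ R).2) (.falsumE (.impE as3 (.orI₁ as0))) as0
    · exact .orE (as0.trans (ih₂ h₂ R).2) (.falsumE (.impE as3 (.orI₂ as0))) as0
  | imp φ ψ ih₁ ih₂ =>
    obtain ⟨h₁, h₂⟩ := degree_imp_le_iff.1 h
    refine ⟨.impI (.orE (as0.trans (ih₁ h₁ R).2) ?_ (tr_of_self as0)), ?_⟩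
    · exact (Derives.impE as2 as0).trans (ih₂ h₂ R).1
    · refine .orE (em_of_degree_le h₁) ?_ (.orI₁ (.impI (.falsumE (.impE as1 as0))))
      refine .orE ((Derives.impE as1 (as0.trans (ih₁ h₁ R).1)).trans (ih₂ h₂ R).2) ?_ (.orI₂ as0)
      exact .orI₁ (.impI as1)
  | all φ ih =>
    have h₁ := degree_le_of_quant true h
    -- If `∀ φ` fails, decide `∃ ¬φ`. A counterexample yields `R` from the translated instance;
    -- without one, deciding each instance proves `∀ φ` after all.
    refine ⟨all_map (ih h₁ R.shift).1, .orE (em_of_degree_le h) (.orI₁ as0) (.orE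
      (em_of_degree_le ((degree_ex_neg φ).trans_le h)) (.orI₂ (.exE as0 ?_)) (.falsumE ?_))⟩
    · exact .orE ((all_shift as3).trans (ih h₁ R.shift).2) (.falsumE (.impE as1 as0)) as0
    · refine .impE as1 (.allI (.orE (em_of_degree_le h₁) as0 (.falsumE ?_)))
      exact .impE (φ := (ex (neg φ)).shift) as1 (ex_shift as0)
  | ex φ ih =>
    have h₁ := degree_le_of_quant false h
    refine ⟨relDN_intro (ex_map (ih h₁ R.shift).1), .orE (em_of_degree_le h) (.orI₁ as0)
      (.orI₂ (relDN_elim as1 (.exE as0 ?_)))⟩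
    refine .orE (as0.trans (ih h₁ R.shift).2) (.falsumE ?_) as0
    exact .impE (φ := (ex φ).shift) as3 (ex_shift as0)

/-- The core below the two outer blocks has degree at most `j` and implies its translation; both
blocks preserve this, with no further excluded middle. -/
theorem Prenex.derives_tr {j : ℕ} (h : Prenex true (j + 2) φ) :
    ∀ R, Derives (HA ∪ LEM j) [φ] (tr R φ) := by
  refine h.block_induction (P := fun φ => ∀ R, Derives (HA ∪ LEM j) [φ] (tr R φ))
    (fun φ h => ?_) fun φ _ ih R => all_map (ih R.shift)
  refine h.block_induction (P := fun φ => ∀ R, Derives (HA ∪ LEM j) [φ] (tr R φ))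
    (fun φ h R => ?_) fun φ _ ih R => relDN_intro (ex_map (ih R.shift))
  exact (tr_equi_of_degree_le (degree_le_iff.2 fun s hs => (h.pathBound s hs).1) R).1

/-- The core yields itself or `R`, and the existential block may be opened because the goal is `R`.
With `R` equal to `φ`, the second assumption is trivial. -/
theorem Prenex.derives_of_tr {j : ℕ} (h : Prenex false (j + 1) φ) :
    ∀ R, Derives (HA ∪ LEM j) [tr R φ, imp φ R] R := by
  refine h.block_induction (P := fun φ => ∀ R, Derives (HA ∪ LEM j) [tr R φ, imp φ R] R)
    (fun φ h R => ?_) fun φ _ ih R => ?_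
  · refine .orE (as0.trans ?_) (.impE as2 as0) as0
    exact (tr_equi_of_degree_le (degree_le_iff.2 fun s hs => (h.pathBound s hs).1) R).2
  · refine relDN_elim as0 (.exE as0 (Derives.cut (φ := imp φ R.shift) (.impI ?_)
      ((ih R.shift).weaken ?_)))
    · exact .impE (φ := (ex φ).shift) as4 (ex_shift as0)
    · intro x hx
      simp only [List.mem_cons, List.not_mem_nil, or_false] at hx
      rcases hx with rfl | rfl <;> simp

/-- Classical arithmetic is conservative for implications between `Π_{j+2}`-formulas over
intuitionistic arithmetic with excluded middle for formulas of degree at most `j`. -/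
theorem conservation {j : ℕ} (hφ : Prenex true (j + 2) φ) (hψ : Prenex true (j + 2) ψ)
    (h : Derives PA [φ] ψ) : Derives (HA ∪ LEM j) [φ] ψ := by
  refine hψ.block_induction (P := fun ψ => ∀ φ, Prenex true (j + 2) φ → Derives PA [φ] ψ →
    Derives (HA ∪ LEM j) [φ] ψ) (fun ψ hψ φ hφ h => ?_) (fun ψ _ ih φ hφ h => ?_) φ hφ h
  -- Here `ψ` is `Σ_{j+1}`, and it is itself taken as the parameter of the translation.
  · have h₁ := (h.tr ψ).mono (B := HA ∪ LEM j) Set.subset_union_left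
    exact Derives.cut ((hφ.derives_tr ψ).trans h₁) (Derives.cut (φ := imp ψ ψ) (.impI as0)
      ((hψ.derives_of_tr ψ).weaken (by simp)))
  · exact .allI (ih φ.shift (hφ.subst _) (all_shift (h.subst PA_subst fun n => v (n + 1))))


/-! ### Universal closures of excluded middle as premises -/

/-- Axioms are read universally and assumptions are not, so an axiom can become an assumption only
through a premise unaffected by shifting, such as a closed formula. -/
theorem Derives.exists_premises {S : Set Fml} {P : Fml → Prop} (hP : ∀ χ, P χ → χ.shift = χ)
    (hS : ∀ φ ∈ S, ∃ χ, P χ ∧ Derives HA [χ] φ) {Γ : List Fml} {φ : Fml}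
    (h : Derives (HA ∪ S) Γ φ) : ∃ Λ : List Fml, (∀ χ ∈ Λ, P χ) ∧ Derives HA (Λ ++ Γ) φ := by
  have hmap : ∀ Λ : List Fml, (∀ χ ∈ Λ, P χ) → Λ.map shift = Λ := fun Λ hΛ =>
    (List.map_congr_left fun χ hχ => hP χ (hΛ χ hχ)).trans (List.map_id Λ)
  have happ : ∀ {Λ Λ' : List Fml}, (∀ χ ∈ Λ, P χ) → (∀ χ ∈ Λ', P χ) → ∀ χ ∈ Λ ++ Λ', P χ :=
    fun h h' χ hχ => (List.mem_append.1 hχ).elim (h χ) (h' χ)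
  induction h with
  | ax h =>
    rcases h with h | h
    · exact ⟨[], by simp, .ax h⟩
    · obtain ⟨χ, hχ, hd⟩ := hS _ h
      exact ⟨[χ], by simpa using hχ, hd.weaken (by simp)⟩
  | assume h => exact ⟨[], by simp, .assume h⟩
  | falsumE _ ih =>
    obtain ⟨Λ, hΛ, h⟩ := ih
    exact ⟨Λ, hΛ, .falsumE h⟩
  | andI _ _ ih₁ ih₂ =>
    obtain ⟨Λ, hΛ, h⟩ := ih₁
    obtain ⟨Λ', hΛ', h'⟩ := ih₂
    exact ⟨Λ ++ Λ', happ hΛ hΛ', .andI (h.weaken (by simp)) (h'.weaken (by simp))⟩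
  | andE₁ _ ih =>
    obtain ⟨Λ, hΛ, h⟩ := ih
    exact ⟨Λ, hΛ, .andE₁ h⟩
  | andE₂ _ ih =>
    obtain ⟨Λ, hΛ, h⟩ := ih
    exact ⟨Λ, hΛ, .andE₂ h⟩
  | orI₁ _ ih =>
    obtain ⟨Λ, hΛ, h⟩ := ih
    exact ⟨Λ, hΛ, .orI₁ h⟩
  | orI₂ _ ih =>
    obtain ⟨Λ, hΛ, h⟩ := ih
    exact ⟨Λ, hΛ, .orI₂ h⟩
  | orE _ _ _ ih₁ ih₂ ih₃ =>
    obtain ⟨Λ₁, hΛ₁, h₁⟩ := ih₁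
    obtain ⟨Λ₂, hΛ₂, h₂⟩ := ih₂
    obtain ⟨Λ₃, hΛ₃, h₃⟩ := ih₃
    refine ⟨Λ₁ ++ (Λ₂ ++ Λ₃), happ hΛ₁ (happ hΛ₂ hΛ₃), .orE (h₁.weaken ?_) (h₂.weaken ?_)
      (h₃.weaken ?_)⟩
    all_goals
      intro x hx
      simp only [List.mem_append, List.mem_cons] at hx ⊢
      tauto
  | impI _ ih =>
    obtain ⟨Λ, hΛ, h⟩ := ih
    exact ⟨Λ, hΛ, .impI (h.weaken fun x hx => by
      simp only [List.mem_append, List.mem_cons] at hx ⊢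
      tauto)⟩
  | impE _ _ ih₁ ih₂ =>
    obtain ⟨Λ, hΛ, h⟩ := ih₁
    obtain ⟨Λ', hΛ', h'⟩ := ih₂
    exact ⟨Λ ++ Λ', happ hΛ hΛ', .impE (h.weaken (by simp)) (h'.weaken (by simp))⟩
  | allI _ ih =>
    obtain ⟨Λ, hΛ, h⟩ := ih
    refine ⟨Λ, hΛ, .allI ?_⟩
    rwa [List.map_append, hmap Λ hΛ]
  | allE t _ ih =>
    obtain ⟨Λ, hΛ, h⟩ := ih
    exact ⟨Λ, hΛ, .allE t h⟩
  | exI t _ ih =>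
    obtain ⟨Λ, hΛ, h⟩ := ih
    exact ⟨Λ, hΛ, .exI t h⟩
  | exE _ _ ih₁ ih₂ =>
    obtain ⟨Λ, hΛ, h⟩ := ih₁
    obtain ⟨Λ', hΛ', h'⟩ := ih₂
    refine ⟨Λ ++ Λ', happ hΛ hΛ', .exE (h.weaken (by simp)) ?_⟩
    rw [List.map_append, hmap _ (happ hΛ hΛ')]
    refine h'.weaken fun x hx => ?_
    simp only [List.mem_append, List.mem_cons] at hx ⊢
    tauto

theorem allBlock_succ (n : ℕ) (φ : Fml) : allBlock (n + 1) φ = all (allBlock n φ) :=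
  Function.iterate_succ_apply' all n φ

theorem mem_FV_allBlock (n i : ℕ) (φ : Fml) : i ∈ FV (allBlock n φ) ↔ i + n ∈ FV φ := by
  induction n generalizing i with
  | zero => rfl
  | succ n ih =>
    rw [allBlock_succ]
    change i + 1 ∈ FV (allBlock n φ) ↔ _
    rw [ih, Nat.add_right_comm, Nat.add_assoc]

theorem derives_of_allBlock {χ : Fml} (hχ : FV χ = ∅) {n : ℕ} {φ : Fml}
    (h : Derives HA [χ] (allBlock n φ)) : Derives HA [χ] φ := by
  induction n with
  | zero => exact h
  | succ n ih =>
    rw [allBlock_succ] at h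
    have := h.subst HA_subst fun n => v (n + 1)
    rw [List.map_cons, subst_of_FV_eq_empty hχ] at this
    exact ih (all_shift this)

theorem exists_closure (φ : Fml) :
    ∃ n, FV (allBlock n φ) = ∅ ∧ Derives HA [allBlock n φ] φ := by
  obtain ⟨n, hn⟩ := FV_bounded φ
  have hFV : FV (allBlock n φ) = ∅ := by
    refine Set.eq_empty_of_forall_notMem fun i hi => ?_
    have := hn _ ((mem_FV_allBlock n i φ).1 hi)
    omega
  exact ⟨n, hFV, derives_of_allBlock hFV as0⟩

theorem proves_of_premises {T : Set Fml} {φ : Fml} {Λ : List Fml}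
    (hΛ : ∀ χ ∈ Λ, Proves T (neg (neg χ))) (h : Derives T Λ (neg φ)) : Proves T (neg φ) := by
  induction Λ with
  | nil => exact h
  | cons χ Λ ih =>
    exact ih (fun χ hχ => hΛ χ (.tail _ hχ)) ((hΛ χ (.head _)).closed.dn_elim h)

/-- The finitely many closures of excluded middle used need only hold doubly negated, since the
conclusion is negated. -/
theorem conservation_dn {T : Set Fml} (hHA : ∀ φ, Proves HA φ → Proves T φ) {j : ℕ}
    (hT : ∀ φ, degree φ ≤ j → ∀ n, Proves T (neg (neg (allBlock n (or φ (neg φ))))))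
    {φ ψ : Fml} (hφ : Prenex true (j + 2) φ) (hψ : Prenex true (j + 2) ψ)
    (h : Derives PA [φ] ψ) : Derives T [φ] (neg (neg ψ)) := by
  have hd := Derives.impI (conservation hφ hψ h)
  obtain ⟨Λ, hΛ, hd⟩ := hd.exists_premises
    (P := fun χ => FV χ = ∅ ∧ Proves T (neg (neg χ)))
    (fun χ hχ => subst_of_FV_eq_empty hχ.1 _) (by
      rintro _ ⟨χ, hχ, rfl⟩
      obtain ⟨n, h₁, h₂⟩ := exists_closure (or χ (neg χ))
      exact ⟨_, ⟨h₁, hT χ hχ n⟩, h₂⟩)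
  rw [List.append_nil] at hd
  have := proves_of_premises (fun χ hχ => (hΛ χ hχ).2) (hd.transfer hHA).dni
  exact this.closed.dn_elim (Derives.dni (.impE as0 as1))

/-- `¬¬(φ ∨ ¬φ)` is intuitionistic. Every prefix of the closure stays within the bound `j + 1`, so
the shift moves the double negation out one quantifier at a time. -/
theorem dn_allBlock_em {T : Set Fml} {j : ℕ} (hD : ∀ φ, PathBound true (j + 1) φ → HasDNS T φ)
    {φ : Fml} (hφ : degree φ ≤ j) (n : ℕ) :
    Proves T (neg (neg (allBlock n (or φ (neg φ))))) := by
  have hb : ∀ n, PathBound true (j + 1) (allBlock n (or φ (neg φ))) := by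
    intro n
    induction n with
    | zero => exact .of_degree_le (degree_or_le_iff.2 ⟨hφ, (degree_neg φ).trans_le hφ⟩)
    | succ n ih =>
      rw [allBlock_succ]
      exact pathBound_quant_iff (b := true).2 ih
  induction n with
  | zero => exact .impI (.impE as0 (.orI₂ (.impI (.impE as1 (.orI₁ as0)))))
  | succ n ih =>
    rw [allBlock_succ]
    exact Derives.trans (.allI ih) (hD _ (hb n))

theorem proves_allBlock {T : Set Fml} {φ : Fml} (h : Proves T φ) (n : ℕ) :
    Proves T (allBlock n φ) := by
  induction n with
  | zero => exact h
  | succ n ih =>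
    rw [allBlock_succ]
    exact .allI ih

theorem Prenex.of_le {b : Bool} {j k : ℕ} {φ : Fml} (h : Prenex b j φ) (hjk : j ≤ k) :
    Prenex b k φ := by
  induction hjk with
  | refl => exact h
  | step _ ih => exact ih.succ

theorem provesSchema_DNS_of_PNFT {T : Set Fml} (hHA : ∀ φ, Proves HA φ → Proves T φ)
    (hPA : ∀ φ, Proves T φ → Proves PA φ) {k : ℕ}
    (h : ∀ k' ≤ k, PNFT T (dnegClass (UClass k')) (dnegClass (PiClass k'))) :
    ProvesSchema T (DNS (UPlusClass k)) := by
  induction k with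
  | zero =>
    rintro _ ⟨φ, hφ, -, rfl⟩
    have hq := (mem_UPlusClass_iff.1 hφ).qf
    refine hHA _ (.allI (.impI (Derives.dni (all_map ?_))))
    exact .orE (HA.em_of_qf hq) as0 (.falsumE (.impE as1 as0))
  | succ k ih =>
    have hD := ih fun k' hk' => h k' (hk'.trans k.le_succ)
    -- For `k = 0`, conservation is used with `j = 0`: `Π_1` is part of `Π_2`, and excluded middle
    -- for quantifier-free formulas is provable in `HA`. For `k = j + 1`, the induction hypothesis
    -- is the shift for `U_{j+1}⁺`, just what the closures at degree `j` require.
    have hcons : ∀ φ ψ, Prenex true (k + 1) φ → Prenex true (k + 1) ψ → Derives PA [φ] ψ →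
        Derives T [φ] (neg (neg ψ)) := by
      intro φ ψ hφ hψ
      cases k with
      | zero =>
        refine conservation_dn hHA (j := 0) (fun χ hχ n => ?_) hφ.succ hψ.succ
        refine Derives.dni (proves_allBlock (hHA _ (HA.em_of_qf (PathBound.qf (b := true) ?_))) n)
        intro s hs
        have := List.length_eq_zero_iff.1 (Nat.le_zero.1 (degree_le_iff.1 hχ s hs))
        subst this
        simp
      | succ j =>
        exact conservation_dn hHA
          (fun χ hχ n => dn_allBlock_em (fun θ hθ => hasDNS_of_pathBound hHA hD hθ) hχ n) hφ hψ
    -- The normal form is taken at the exact degree of `∀ φ`, which may be below `k + 1`; this is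
    -- why all `k'` up to the bound are needed.
    have hnf : ∀ φ, PathBound true (k + 1) φ → ∃ χ, Prenex true (k + 1) χ ∧
        Proves T (iff (neg (neg (all φ))) (neg (neg χ))) := by
      intro φ hφ
      have hd : degree (all φ) ≤ k + 1 := degree_le_iff.2 fun s hs =>
        (pathBound_quant_iff (b := true).2 hφ s hs).1
      obtain ⟨_, ⟨χ, hχ, rfl⟩, -, hiff⟩ := h _ hd _ ⟨all φ, all_mem_UClass φ, rfl⟩
      exact ⟨χ, (mem_PiClass_iff.1 hχ).of_le hd, hiff⟩
    rintro _ ⟨φ, hφ, -, rfl⟩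
    have hφ := mem_UPlusClass_iff.1 hφ
    obtain ⟨α, hα, hα'⟩ := hnf (neg (neg φ))
      (pathBound_neg_iff.2 (pathBound_neg_iff.2 (by rwa [Bool.not_not])))
    obtain ⟨β, hβ, hβ'⟩ := hnf φ hφ
    -- Classically `α` and `β` are both equivalent to `∀ φ`.
    have hαβ : Derives PA [α] β := by
      have h₁ : Derives PA [α] (all (neg (neg φ))) :=
        PA_dne (.impE (hPA _ hα').andE₂.closed as0.dni)
      have h₂ : Derives PA [α] (all φ) := h₁.trans (all_map (PA_dne as0))
      exact PA_dne (.impE (hPA _ hβ').andE₁.closed h₂.dni)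
    refine .allI (.impI (.impE hβ'.andE₂.closed ?_))
    exact Derives.dn_elim (.impE hα'.andE₁.closed as0.dni) (as0.trans (hcons α β hα hβ hαβ))

end SemiClassical

theorem mainTheorem6 (T : Set Fml)
    (hHA : ∀ φ : Fml, Proves HA φ → Proves T φ)
    (hPA : ∀ φ : Fml, Proves T φ → Proves PA φ)
    (k : ℕ) :
    List.TFAE
      [ProvesSchema T (DNS (UPlusClass k)),
        ∀ k' ≤ k, PNFT T (negClass (EClass k')) (dnegClass (PiClass k')),
        ∀ k' ≤ k, PNFT T (dnegClass (UClass k')) (dnegClass (PiClass k'))] := by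
  tfae_have 1 → 2 := fun h _ hk => PNFT_neg_EClass hHA h hk
  tfae_have 2 → 3 := by
    rintro h k' hk _ ⟨φ, hφ, rfl⟩
    -- `¬¬φ` is the negation of `¬φ`, and negation carries `U_k'` into `E_k'`.
    exact h k' hk _ ⟨Fml.neg φ, neg_mem_EClass hφ, rfl⟩
  tfae_have 3 → 1 := provesSchema_DNS_of_PNFT hHA hPA
  tfae_finish
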